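/- Let $n\ge 3$ and let $H$ be a group. For groups, $\equiv$ denotes elementary equivalence in the first-order language of groups; for fields, it denotes elementary equivalence in the first-order language of rings. For a field $L$ let $d_1=\mathrm{diag}(-1,1,\dots,1)\in GL_n(L)$, and let $SL_n(L)\cdot\langle d_1\rangle\le GL_n(L)$ be the product of $SL_n(L)$ and the cyclic subgroup generated by $d_1$. Let $B(H)=\{z^2 : z\in Z(H)\}$, a subgroup of the center $Z(H)$ of $H$, and let $(\mathbb R_{>0})^\times$ be the multiplicative group of positive reals. Then the following are equivalent: 1. $H\equiv GL_n(\mathbb R)$; 2. $H\cong (SL_n(L)\cdot\langle d_1\rangle)\times B(H)$ for some field $L\equiv\mathbb R$, and $B(H)\equiv(\mathbb R_{>0})^\times$; 3. $H\cong (SL_n(L)\cdot\langle d_1\rangle)\times B$ for some field $L\equiv\mathbb R$ and some group $B\equiv(\mathbb R_{>0})^\times$. -/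

import Mathlib

open FirstOrder
open scoped MatrixGroups

universe u

/-- Function symbols of the language of groups: `·`, `⁻¹`, `1`. -/
inductive GroupFunc : ℕ → Type
  | mul : GroupFunc 2
  | inv : GroupFunc 1
  | one : GroupFunc 0

/-- The first-order language of groups `{·, ⁻¹, 1}`. -/
def groupLanguage : Language where
  Functions := GroupFunc
  Relations := fun _ => Empty

/-- Every group is a structure for the language of groups. -/
instance groupLanguageStructure (G : Type*) [Group G] : groupLanguage.Structure G where
  funMap := fun {k} f =>
    match k, f with
    | _, GroupFunc.mul => fun x => x 0 * x 1
    | _, GroupFunc.inv => fun x => (x 0)⁻¹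
    | _, GroupFunc.one => fun _ => 1
  RelMap := fun {_} r => nomatch r

/-- Elementary equivalence of groups: the same sentences of the language of groups hold. -/
def GroupElemEquiv (G H : Type*) [Group G] [Group H] : Prop :=
  groupLanguage.ElementarilyEquivalent G H

/-- Elementary equivalence of fields: the same sentences of the language of rings hold. -/
def FieldElemEquiv (K L : Type*) [Field K] [Field L] : Prop :=
  letI := Ring.compatibleRingOfRing K
  letI := Ring.compatibleRingOfRing L
  Language.ring.ElementarilyEquivalent K L

/-- The diagonal matrix `d_1(α) = diag(α, 1, …, 1)` as an element of `GL_n(L)`. -/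
def dOne (n : ℕ) {L : Type*} [Field L] (α : Lˣ) : GL (Fin n) L where
  val := Matrix.diagonal fun i => if (i : ℕ) = 0 then (α : L) else 1
  inv := Matrix.diagonal fun i => if (i : ℕ) = 0 then ((α⁻¹ : Lˣ) : L) else 1
  val_inv := by
    rw [Matrix.diagonal_mul_diagonal, ← Matrix.diagonal_one]
    congr 1; funext i; split_ifs <;> simp
  inv_val := by
    rw [Matrix.diagonal_mul_diagonal, ← Matrix.diagonal_one]
    congr 1; funext i; split_ifs <;> simp

/-- The subgroup `SL_n(L) · ⟨d_1⟩` of `GL_n(L)`, where `d_1 = d_1(-1) = diag(-1, 1, …, 1)`.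
(`SL_n(L)` is normal, so the product set is the subgroup generated by the two factors.) -/
def slDOne (n : ℕ) (L : Type*) [Field L] : Subgroup (GL (Fin n) L) :=
  (Matrix.SpecialLinearGroup.toGL (n := Fin n) (R := L)).range ⊔
    Subgroup.zpowers (dOne n (-1 : Lˣ))

/-- The subgroup `B(H) = {z² | z ∈ Z(H)}` of `H`. -/
def centerSquares (H : Type*) [Group H] : Subgroup H where
  carrier := {x | ∃ z ∈ Subgroup.center H, z ^ 2 = x}
  one_mem' := ⟨1, Subgroup.one_mem _, one_pow 2⟩
  mul_mem' := by
    rintro _ _ ⟨a, ha, rfl⟩ ⟨b, hb, rfl⟩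
    exact ⟨a * b, Subgroup.mul_mem _ ha hb,
      Commute.mul_pow ((Subgroup.mem_center_iff.mp hb) a) 2⟩
  inv_mem' := by
    rintro _ ⟨a, ha, rfl⟩
    exact ⟨a⁻¹, Subgroup.inv_mem _ ha, inv_pow a 2⟩

/-! ### Elementary equivalence and isomorphisms -/

/-! Every nonzero real is, up to sign, `b ^ (2 * n)` with `b ^ 2` unique. Hence each real invertible
matrix is uniquely `A * z ^ 2` with `det A = ±1` and `z` scalar, so `GL_n(ℝ)` is the direct product
of `slDOne n ℝ` and its group of squares of central elements, which is a copy of the positive reals.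
The task is to see this decomposition, and the field, in first-order terms.

A root subgroup `{1 + b E₀₁}` is definable from one of its elements `X` (`lineSet`), and the
commutator `[e₀₂(a), e₂₁(b)] = e₀₁(ab)` defines the field multiplication on it (`lineMul`). Every
matrix of determinant `±1` is a product of a bounded number of elementary matrices and `d_1`, and
the multiplication of such words is governed by polynomial identities over the field. So the
existence of a `CoordinatizingFrame` is a single first-order sentence. It holds in `GL_n(ℝ)`
(`exists_coordinatizingFrame_GL`), hence in every `H ≡ GL_n(ℝ)`, and it yields `H ≅ slDOne n L ×
B(H)` with `L` the field of the frame.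

The frame found in `H` need not resemble the standard one, so for `L ≡ ℝ` one shows that every frame
of `GL_n(ℝ)`, however exotic, has a field isomorphic to `ℝ` (`IsFieldLine.nonempty_ringEquiv`). Each
sentence true in `ℝ` is then true in the fields of all frames, which is again a group sentence and
passes to `H`.

Conversely, `slDOne n L` is interpretable in `L`, and direct products preserve elementary
equivalence (`GroupElemEquiv.prod`, a case of the Feferman–Vaught theorem). So any product as in the
third condition is elementarily equivalent to the decomposition of `GL_n(ℝ)`. -/

theorem GroupElemEquiv.of_mulEquiv {G H : Type*} [Group G] [Group H] (f : G ≃* H) :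
    GroupElemEquiv G H := by
  let g : groupLanguage.Equiv G H :=
    { f.toEquiv with
      map_fun' := by
        rintro n φ x
        cases φ
        · exact map_mul f _ _
        · exact map_inv f _
        · exact map_one f
      map_rel' := by rintro n r; cases r }
  exact Language.StrongHomClass.elementarilyEquivalent g

theorem GroupElemEquiv.symm {G H : Type*} [Group G] [Group H] (h : GroupElemEquiv G H) :
    GroupElemEquiv H G := Eq.symm h

theorem GroupElemEquiv.trans {G H K : Type*} [Group G] [Group H] [Group K]
    (h : GroupElemEquiv G H) (h' : GroupElemEquiv H K) : GroupElemEquiv G K := Eq.trans h h'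

theorem FieldElemEquiv.of_ringEquiv {K L : Type*} [Field K] [Field L] (f : K ≃+* L) :
    FieldElemEquiv K L := by
  letI := Ring.compatibleRingOfRing K
  letI := Ring.compatibleRingOfRing L
  exact Language.StrongHomClass.elementarilyEquivalent (Ring.languageEquivEquivRingEquiv.symm f)

theorem FieldElemEquiv.symm {K L : Type*} [Field K] [Field L] (h : FieldElemEquiv K L) :
    FieldElemEquiv L K := Eq.symm h

theorem FieldElemEquiv.trans {K L M : Type*} [Field K] [Field L] [Field M]
    (h : FieldElemEquiv K L) (h' : FieldElemEquiv L M) : FieldElemEquiv K M := Eq.trans h h'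

/-! ### Interpretations -/

/-- An interpretation (with parameters indexed by `P`, in dimension `ι`) of structures of an
algebraic language `L'` in structures of a language `L`, the operations being given by terms. -/
structure TermInterpretation (L L' : FirstOrder.Language.{0, 0}) (P ι : Type) where
  dom : L.Formula (ι ⊕ P)
  fn : ∀ {k : ℕ}, L'.Functions k → ι → L.Term ((Fin k × ι) ⊕ P)

/-- `c` identifies the `L'`-structure `N` with the one interpreted in `M` with parameters `p`. -/
structure TermInterpretation.Realizes {L L' : FirstOrder.Language.{0, 0}} {P ι : Type}
    (I : TermInterpretation L L' P ι) {M N : Type*} [L.Structure M] [L'.Structure N]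
    (p : P → M) (c : N → ι → M) : Prop where
  injective : Function.Injective c
  dom_iff : ∀ y, I.dom.Realize (Sum.elim y p) ↔ ∃ a, c a = y
  map_fn : ∀ {k : ℕ} (f : L'.Functions k) (x : Fin k → N) (i : ι),
    c (Language.Structure.funMap f x) i =
      (I.fn f i).realize (Sum.elim (fun q => c (x q.1) q.2) p)

namespace TermInterpretation

variable {L L' : FirstOrder.Language.{0, 0}} {P ι : Type} (I : TermInterpretation L L' P ι)

theorem exists_term {α : Type} (t : L'.Term α) :
    ∃ s : ι → L.Term ((α × ι) ⊕ P), ∀ (M N : Type u) [L.Structure M] [L'.Structure N]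
      (p : P → M) (c : N → ι → M), I.Realizes p c → ∀ (v : α → N) (i : ι),
      c (t.realize v) i = (s i).realize (Sum.elim (fun q => c (v q.1) q.2) p) := by
  induction t with
  | var a => exact ⟨fun i => Language.Term.var (Sum.inl (a, i)), by intros; rfl⟩
  | func f ts ih =>
    choose s hs using ih
    refine ⟨fun i => (I.fn f i).subst
      (Sum.elim (fun q => s q.1 q.2) fun b => Language.Term.var (Sum.inr b)), ?_⟩
    intro M N _ _ p c h v i
    rw [Language.Term.realize_func, h.map_fn, Language.Term.realize_subst]
    congr 1
    funext q
    rcases q with q | q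
    · exact hs _ M N p c h v _
    · rfl

/-- By injectivity of `c`, an equation becomes the conjunction of its coordinate equations, and a
quantifier becomes one over `ι`-tuples relativized to `dom`. The translation `ψ` depends on neither
structure, which is what permits transfer. -/
theorem exists_boundedFormula [Finite ι] [L'.IsAlgebraic] {α : Type} {k : ℕ}
    (φ : L'.BoundedFormula α k) :
    ∃ ψ : L.Formula (((α ⊕ Fin k) × ι) ⊕ P), ∀ (M N : Type u) [L.Structure M] [L'.Structure N]
      (p : P → M) (c : N → ι → M), I.Realizes p c → ∀ (v : α → N) (xs : Fin k → N),
      φ.Realize v xs ↔ ψ.Realize (Sum.elim (fun q => c (Sum.elim v xs q.1) q.2) p) := by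
  induction φ with
  | falsum => exact ⟨⊥, by intros; rfl⟩
  | equal t₁ t₂ =>
    obtain ⟨s₁, h₁⟩ := I.exists_term.{u} t₁
    obtain ⟨s₂, h₂⟩ := I.exists_term.{u} t₂
    refine ⟨Language.Formula.iInf fun i => (s₁ i).equal (s₂ i), ?_⟩
    intro M N _ _ p c h v xs
    simp only [Language.Formula.realize_iInf, Language.Formula.realize_equal,
      ← h₁ M N p c h, ← h₂ M N p c h]
    change t₁.realize (Sum.elim v xs) = t₂.realize (Sum.elim v xs) ↔ _
    rw [← h.injective.eq_iff, funext_iff]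
  | rel R => exact isEmptyElim R
  | imp φ₁ φ₂ ih₁ ih₂ =>
    obtain ⟨ψ₁, h₁⟩ := ih₁
    obtain ⟨ψ₂, h₂⟩ := ih₂
    refine ⟨ψ₁.imp ψ₂, ?_⟩
    intro M N _ _ p c h v xs
    rw [Language.Formula.realize_imp, ← h₁ M N p c h, ← h₂ M N p c h]
    rfl
  | @all k φ ih =>
    obtain ⟨ψ, hψ⟩ := ih
    -- The coordinates of the last variable, the one being bound, become the new tuple variable; all
    -- others stay in place.
    let g : ((α ⊕ Fin (k + 1)) × ι) ⊕ P → (((α ⊕ Fin k) × ι) ⊕ P) ⊕ ι :=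
      Sum.elim (fun q => Sum.elim (fun a => Sum.inl (Sum.inl (Sum.inl a, q.2)))
        (fun j => Fin.lastCases (motive := fun _ => (((α ⊕ Fin k) × ι) ⊕ P) ⊕ ι) (Sum.inr q.2)
          (fun j' => Sum.inl (Sum.inl (Sum.inr j', q.2))) j) q.1)
        fun b => Sum.inl (Sum.inr b)
    let d : ι ⊕ P → (((α ⊕ Fin k) × ι) ⊕ P) ⊕ ι :=
      Sum.elim (fun i => Sum.inr i) fun b => Sum.inl (Sum.inr b)
    refine ⟨((I.dom.relabel d).imp (ψ.relabel g)).iAlls ι, ?_⟩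
    intro M N _ _ p c h v xs
    rw [Language.Formula.realize_iAlls]
    simp only [Language.Formula.realize_imp, Language.Formula.realize_relabel]
    change (∀ a : N, φ.Realize v (Fin.snoc xs a)) ↔ _
    have hd : ∀ y : ι → M, (fun a => Sum.elim (Sum.elim (fun q : (α ⊕ Fin k) × ι =>
        c (Sum.elim v xs q.1) q.2) p) y a) ∘ d = Sum.elim y p := by
      intro y; funext q; rcases q with q | q <;> rfl
    have hg : ∀ a : N, (fun b => Sum.elim (Sum.elim (fun q : (α ⊕ Fin k) × ι =>
        c (Sum.elim v xs q.1) q.2) p) (c a) b) ∘ g =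
        Sum.elim (fun q => c (Sum.elim v (Fin.snoc xs a) q.1) q.2) p := by
      intro a; funext q
      rcases q with ⟨q | q, i⟩ | q
      · rfl
      · refine Fin.lastCases ?_ (fun j => ?_) q <;> simp [g]
      · rfl
    constructor
    · intro H y hy
      rw [hd, h.dom_iff] at hy
      obtain ⟨a, rfl⟩ := hy
      rw [hg, ← hψ M N p c h]
      exact H a
    · intro H a
      have := H (c a) (by rw [hd, h.dom_iff]; exact ⟨a, rfl⟩)
      rwa [hg, ← hψ M N p c h] at this

theorem exists_formula [Finite ι] [L'.IsAlgebraic] {α : Type} (φ : L'.Formula α) :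
    ∃ ψ : L.Formula ((α × ι) ⊕ P), ∀ (M N : Type u) [L.Structure M] [L'.Structure N]
      (p : P → M) (c : N → ι → M), I.Realizes p c → ∀ (v : α → N),
      φ.Realize v ↔ ψ.Realize (Sum.elim (fun q => c (v q.1) q.2) p) := by
  obtain ⟨ψ, hψ⟩ := I.exists_boundedFormula.{u} φ
  refine ⟨ψ.relabel (Sum.map (Prod.map (Sum.elim id Fin.elim0) id) id), ?_⟩
  intro M N _ _ p c h v
  rw [Language.Formula.realize_relabel, Language.Formula.Realize, hψ M N p c h]
  apply iff_of_eq
  congr 1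
  funext q
  rcases q with ⟨q | q, i⟩ | q
  · rfl
  · exact q.elim0
  · rfl

theorem elementarilyEquivalent [Finite ι] [L'.IsAlgebraic] (J : TermInterpretation L L' Empty ι)
    {M M' N N' : Type u} [L.Structure M] [L.Structure M'] [L'.Structure N] [L'.Structure N']
    {c : N → ι → M} {c' : N' → ι → M'} (h : J.Realizes Empty.elim c)
    (h' : J.Realizes Empty.elim c') (e : L.ElementarilyEquivalent M M') :
    L'.ElementarilyEquivalent N N' := by
  rw [Language.elementarilyEquivalent_iff]
  intro φ
  obtain ⟨ψ, hψ⟩ := J.exists_formula.{u} φ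
  have key : ∀ (A B : Type u) [L.Structure A] [L'.Structure B] (d : B → ι → A),
      J.Realizes Empty.elim d →
      (φ.Realize B ↔ (ψ.relabel (Sum.elim Prod.fst id)).Realize (default : Empty → A)) := by
    intro A B _ _ d hd
    rw [Language.Formula.realize_relabel]
    refine (hψ A B _ d hd default).trans (iff_of_eq ?_)
    congr 1
    funext q
    rcases q with ⟨q, _⟩ | q <;> exact q.elim
  rw [key M N c h, key M' N' c' h']
  exact e.realize_sentence _

end TermInterpretation

/-! ### Direct products -/

instance : groupLanguage.IsAlgebraic := fun _ => inferInstanceAs (IsEmpty Empty)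

/-- `P` is a relation on products of two groups which is a finite union of rectangles of
uniformly definable relations on the factors. -/
def RectDefinable {α : Type} {k : ℕ}
    (P : ∀ (A B : Type u) [Group A] [Group B], (α → A × B) → (Fin k → A × B) → Prop) : Prop :=
  ∃ l : List (groupLanguage.BoundedFormula α k × groupLanguage.BoundedFormula α k),
    ∀ (A B : Type u) [Group A] [Group B] (v : α → A × B) (xs : Fin k → A × B),
      P A B v xs ↔ ∃ q ∈ l, q.1.Realize (fun a => (v a).1) (fun i => (xs i).1) ∧
        q.2.Realize (fun a => (v a).2) (fun i => (xs i).2)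

namespace RectDefinable

variable {α : Type} {k : ℕ}
  {P Q : ∀ (A B : Type u) [Group A] [Group B], (α → A × B) → (Fin k → A × B) → Prop}

theorem or (hP : RectDefinable P) (hQ : RectDefinable Q) :
    RectDefinable fun A B _ _ v xs => P A B v xs ∨ Q A B v xs := by
  obtain ⟨l, hl⟩ := hP
  obtain ⟨m, hm⟩ := hQ
  refine ⟨l ++ m, fun A B _ _ v xs => ?_⟩
  change (P A B v xs ∨ Q A B v xs) ↔ _
  rw [hl, hm]
  simp only [List.mem_append, or_and_right, exists_or]

theorem and (hP : RectDefinable P) (hQ : RectDefinable Q) :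
    RectDefinable fun A B _ _ v xs => P A B v xs ∧ Q A B v xs := by
  obtain ⟨l, hl⟩ := hP
  obtain ⟨m, hm⟩ := hQ
  refine ⟨(l ×ˢ m).map fun q => (q.1.1 ⊓ q.2.1, q.1.2 ⊓ q.2.2), fun A B _ _ v xs => ?_⟩
  change (P A B v xs ∧ Q A B v xs) ↔ _
  rw [hl, hm]
  constructor
  · rintro ⟨⟨q, hq, h₁, h₂⟩, r, hr, h₃, h₄⟩
    exact ⟨_, List.mem_map.2 ⟨(q, r), List.mem_product.2 ⟨hq, hr⟩, rfl⟩, by simp [h₁, h₃],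
      by simp [h₂, h₄]⟩
  · rintro ⟨_, hq, h₁, h₂⟩
    obtain ⟨⟨q, r⟩, hqr, rfl⟩ := List.mem_map.1 hq
    obtain ⟨hq, hr⟩ := List.mem_product.1 hqr
    simp only [Language.BoundedFormula.realize_inf] at h₁ h₂
    exact ⟨⟨q, hq, h₁.1, h₂.1⟩, r, hr, h₁.2, h₂.2⟩

/-- The complement of a rectangle is a union of two rectangles, and an intersection of finite unions
of rectangles is again one. -/
theorem not (hP : RectDefinable P) : RectDefinable fun A B _ _ v xs => ¬ P A B v xs := by
  obtain ⟨l, hl⟩ := hP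
  suffices h : RectDefinable fun (A B : Type u) [Group A] [Group B] (v : α → A × B)
      (xs : Fin k → A × B) => ¬ ∃ q ∈ l, q.1.Realize (fun a => (v a).1) (fun i => (xs i).1) ∧
        q.2.Realize (fun a => (v a).2) (fun i => (xs i).2) by
    obtain ⟨m, hm⟩ := h
    exact ⟨m, fun A B _ _ v xs => (not_congr (hl A B v xs)).trans (hm A B v xs)⟩
  clear hl
  induction l with
  | nil => exact ⟨[(⊤, ⊤)], by simp⟩
  | cons q l ih =>
    have h₀ : RectDefinable fun (A B : Type u) [Group A] [Group B] (v : α → A × B)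
        (xs : Fin k → A × B) => ¬ (q.1.Realize (fun a => (v a).1) (fun i => (xs i).1) ∧
        q.2.Realize (fun a => (v a).2) (fun i => (xs i).2)) :=
      ⟨[(q.1.not, ⊤), (⊤, q.2.not)], fun A B _ _ v xs => by simp [← not_and_or]⟩
    obtain ⟨m, hm⟩ := h₀.and ih
    exact ⟨m, fun A B _ _ v xs => by rw [← hm]; simp [not_or, -not_and]⟩

/-- A witness in a product is a pair of independent witnesses, so the projection of a rectangle is a
rectangle. -/
theorem exists_snoc
    {R : ∀ (A B : Type u) [Group A] [Group B], (α → A × B) → (Fin (k + 1) → A × B) → Prop}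
    (hR : RectDefinable R) :
    RectDefinable fun A B _ _ v (xs : Fin k → A × B) => ∃ x, R A B v (Fin.snoc xs x) := by
  obtain ⟨l, hl⟩ := hR
  refine ⟨l.map fun q => (q.1.ex, q.2.ex), fun A B _ _ v xs => ?_⟩
  have h₁ : ∀ x : A × B, (fun i => ((Fin.snoc xs x : Fin (k + 1) → A × B) i).1) =
      Fin.snoc (fun i => (xs i).1) x.1 := fun x => by
    funext i; refine Fin.lastCases ?_ (fun j => ?_) i <;> simp
  have h₂ : ∀ x : A × B, (fun i => ((Fin.snoc xs x : Fin (k + 1) → A × B) i).2) =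
      Fin.snoc (fun i => (xs i).2) x.2 := fun x => by
    funext i; refine Fin.lastCases ?_ (fun j => ?_) i <;> simp
  simp only [hl, h₁, h₂, List.mem_map]
  constructor
  · rintro ⟨x, q, hq, h, h'⟩
    exact ⟨_, ⟨q, hq, rfl⟩, Language.BoundedFormula.realize_ex.2 ⟨_, h⟩,
      Language.BoundedFormula.realize_ex.2 ⟨_, h'⟩⟩
  · rintro ⟨_, ⟨q, hq, rfl⟩, h, h'⟩
    obtain ⟨a, ha⟩ := Language.BoundedFormula.realize_ex.1 h
    obtain ⟨b, hb⟩ := Language.BoundedFormula.realize_ex.1 h'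
    exact ⟨(a, b), q, hq, ha, hb⟩

theorem of_boundedFormula (φ : groupLanguage.BoundedFormula α k) :
    RectDefinable.{u} fun _ _ _ _ v xs => φ.Realize v xs := by
  induction φ with
  | falsum => exact ⟨[], by intros; simp [Language.BoundedFormula.Realize]⟩
  | @equal k t₁ t₂ =>
    have key : ∀ (A B : Type u) [Group A] [Group B] (w : α ⊕ Fin k → A × B)
        (t : groupLanguage.Term (α ⊕ Fin k)), t.realize w =
        (t.realize (fun i => (w i).1), t.realize (fun i => (w i).2)) := by
      intro A B _ _ w t
      induction t with
      | var => rfl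
      | func f ts ih =>
        simp only [Language.Term.realize_func, ih]
        cases f <;> rfl
    refine ⟨[(t₁.bdEqual t₂, t₁.bdEqual t₂)], fun A B _ _ v xs => ?_⟩
    have h : ∀ (C : Type u) (f : A × B → C), (fun i => f (Sum.elim v xs i)) =
        Sum.elim (fun a => f (v a)) (fun i => f (xs i)) := by
      intro C f; funext i; rcases i with i | i <;> rfl
    simp only [List.mem_singleton, exists_eq_left, Language.BoundedFormula.realize_bdEqual]
    change t₁.realize (Sum.elim v xs) = t₂.realize (Sum.elim v xs) ↔ _
    rw [key, key, Prod.mk.injEq, h A Prod.fst, h B Prod.snd]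
  | rel R => exact isEmptyElim R
  | imp φ ψ ih₁ ih₂ =>
    obtain ⟨l, hl⟩ := ih₁.not.or ih₂
    refine ⟨l, fun A B _ _ v xs => ?_⟩
    rw [← hl]
    exact (Language.BoundedFormula.realize_imp).trans imp_iff_not_or
  | all φ ih =>
    obtain ⟨l, hl⟩ := ih.not.exists_snoc.not
    refine ⟨l, fun A B _ _ v xs => ?_⟩
    rw [← hl]
    exact Language.BoundedFormula.realize_all.trans not_exists_not.symm

end RectDefinable

/-- Without free variables, rectangle-definability says that truth in a product depends only on the
truth of finitely many fixed sentences in the factors. -/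
theorem GroupElemEquiv.prod {A A' B B' : Type u} [Group A] [Group A'] [Group B] [Group B']
    (hA : GroupElemEquiv A A') (hB : GroupElemEquiv B B') :
    GroupElemEquiv (A × B) (A' × B') := by
  rw [GroupElemEquiv, Language.elementarilyEquivalent_iff] at *
  intro φ
  obtain ⟨l, hl⟩ := RectDefinable.of_boundedFormula.{u} φ
  have key : ∀ (C D : Type u) [Group C] [Group D], φ.Realize (C × D) ↔
      ∃ q ∈ l, Language.Sentence.Realize C q.1 ∧ Language.Sentence.Realize D q.2 := by
    intro C D _ _
    refine (hl C D default default).trans (exists_congr fun q => and_congr_right fun _ => ?_)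
    unfold Language.Sentence.Realize Language.Formula.Realize
    apply iff_of_eq
    congr!
  rw [key, key]
  exact exists_congr fun q => by rw [hA, hB]

/-! ### Uniformly definable relations on groups -/

/-- `f` is given, uniformly in all groups, by a term of the language of groups. -/
def GroupTerm {α : Type} (f : ∀ (M : Type u) [Group M], (α → M) → M) : Prop :=
  ∃ t : groupLanguage.Term α, ∀ (M : Type u) [Group M] (v : α → M), t.realize v = f M v

/-- `P` is defined, uniformly in all groups, by a formula of the language of groups. -/
def GroupDefinable {α : Type} (P : ∀ (M : Type u) [Group M], (α → M) → Prop) : Prop :=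
  ∃ φ : groupLanguage.Formula α, ∀ (M : Type u) [Group M] (v : α → M), φ.Realize v ↔ P M v

namespace GroupTerm

variable {α : Type} {f g : ∀ (M : Type u) [Group M], (α → M) → M}

theorem var (a : α) : GroupTerm.{u} fun _ _ v => v a :=
  ⟨Language.Term.var a, fun _ _ _ => rfl⟩

theorem one : GroupTerm.{u} fun M _ (_ : α → M) => 1 :=
  ⟨Language.Term.func GroupFunc.one Fin.elim0, fun _ _ _ => rfl⟩

theorem mul (hf : GroupTerm f) (hg : GroupTerm g) : GroupTerm fun M _ v => f M v * g M v := by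
  obtain ⟨s, hs⟩ := hf
  obtain ⟨t, ht⟩ := hg
  refine ⟨Language.Term.func GroupFunc.mul ![s, t], fun M _ v => ?_⟩
  change s.realize v * t.realize v = f M v * g M v
  rw [hs, ht]

theorem inv (hf : GroupTerm f) : GroupTerm fun M _ v => (f M v)⁻¹ := by
  obtain ⟨s, hs⟩ := hf
  refine ⟨Language.Term.func GroupFunc.inv ![s], fun M _ v => ?_⟩
  change (s.realize v)⁻¹ = (f M v)⁻¹
  rw [hs]

theorem listProd {κ : Type} (l : List κ) {h : κ → ∀ (M : Type u) [Group M], (α → M) → M}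
    (hh : ∀ k, GroupTerm (h k)) : GroupTerm fun M _ v => (l.map fun k => h k M v).prod := by
  induction l with
  | nil => exact one
  | cons k l ih => simpa only [List.map_cons, List.prod_cons] using (hh k).mul ih

end GroupTerm

namespace GroupDefinable

variable {α : Type} {P Q : ∀ (M : Type u) [Group M], (α → M) → Prop}

theorem eq {f g : ∀ (M : Type u) [Group M], (α → M) → M} (hf : GroupTerm f) (hg : GroupTerm g) :
    GroupDefinable fun M _ v => f M v = g M v := by
  obtain ⟨s, hs⟩ := hf
  obtain ⟨t, ht⟩ := hg
  exact ⟨s.equal t, fun M _ v => by rw [Language.Formula.realize_equal, hs, ht]⟩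

theorem realize {β : Type} (φ : groupLanguage.Formula β)
    {f : β → ∀ (M : Type u) [Group M], (α → M) → M} (hf : ∀ b, GroupTerm (f b)) :
    GroupDefinable fun M _ v => φ.Realize fun b => f b M v := by
  choose t ht using hf
  refine ⟨Language.BoundedFormula.subst φ t, fun M _ v => ?_⟩
  rw [Language.Formula.Realize, Language.BoundedFormula.realize_subst]
  simp only [ht]
  rfl

theorem not (hP : GroupDefinable P) : GroupDefinable fun M _ v => ¬ P M v := by
  obtain ⟨φ, hφ⟩ := hP
  exact ⟨φ.not, fun M _ v => by rw [Language.Formula.realize_not, hφ]⟩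

theorem and (hP : GroupDefinable P) (hQ : GroupDefinable Q) :
    GroupDefinable fun M _ v => P M v ∧ Q M v := by
  obtain ⟨φ, hφ⟩ := hP
  obtain ⟨ψ, hψ⟩ := hQ
  exact ⟨φ ⊓ ψ, fun M _ v => by rw [Language.Formula.realize_inf, hφ, hψ]⟩

theorem or (hP : GroupDefinable P) (hQ : GroupDefinable Q) :
    GroupDefinable fun M _ v => P M v ∨ Q M v := by
  obtain ⟨φ, hφ⟩ := hP
  obtain ⟨ψ, hψ⟩ := hQ
  exact ⟨φ ⊔ ψ, fun M _ v => by rw [Language.Formula.realize_sup, hφ, hψ]⟩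

theorem imp (hP : GroupDefinable P) (hQ : GroupDefinable Q) :
    GroupDefinable fun M _ v => P M v → Q M v := by
  obtain ⟨φ, hφ⟩ := hP
  obtain ⟨ψ, hψ⟩ := hQ
  exact ⟨φ.imp ψ, fun M _ v => by rw [Language.Formula.realize_imp, hφ, hψ]⟩

theorem iff (hP : GroupDefinable P) (hQ : GroupDefinable Q) :
    GroupDefinable fun M _ v => (P M v ↔ Q M v) := by
  obtain ⟨φ, hφ⟩ := hP
  obtain ⟨ψ, hψ⟩ := hQ
  exact ⟨φ.iff ψ, fun M _ v => by rw [Language.Formula.realize_iff, hφ, hψ]⟩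

theorem forall_index {κ : Type} [Finite κ] {R : κ → ∀ (M : Type u) [Group M], (α → M) → Prop}
    (hR : ∀ k, GroupDefinable (R k)) : GroupDefinable fun M _ v => ∀ k, R k M v := by
  choose φ hφ using hR
  exact ⟨Language.Formula.iInf φ, fun M _ v => by simp only [Language.Formula.realize_iInf, hφ]⟩

theorem exists_index {κ : Type} [Finite κ] {R : κ → ∀ (M : Type u) [Group M], (α → M) → Prop}
    (hR : ∀ k, GroupDefinable (R k)) : GroupDefinable fun M _ v => ∃ k, R k M v := by
  choose φ hφ using hR
  exact ⟨Language.Formula.iSup φ, fun M _ v => by simp only [Language.Formula.realize_iSup, hφ]⟩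

theorem forall_tuple {ι : Type} [Finite ι]
    {R : ∀ (M : Type u) [Group M], (α → M) → (ι → M) → Prop}
    (hR : GroupDefinable fun M _ (w : α ⊕ ι → M) =>
      R M (fun a => w (Sum.inl a)) fun i => w (Sum.inr i)) :
    GroupDefinable fun M _ v => ∀ x, R M v x := by
  obtain ⟨φ, hφ⟩ := hR
  exact ⟨φ.iAlls ι, fun M _ v => by simp only [Language.Formula.realize_iAlls, hφ]; rfl⟩

theorem exists_tuple {ι : Type} [Finite ι]
    {R : ∀ (M : Type u) [Group M], (α → M) → (ι → M) → Prop}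
    (hR : GroupDefinable fun M _ (w : α ⊕ ι → M) =>
      R M (fun a => w (Sum.inl a)) fun i => w (Sum.inr i)) :
    GroupDefinable fun M _ v => ∃ x, R M v x := by
  obtain ⟨φ, hφ⟩ := hR
  exact ⟨φ.iExs ι, fun M _ v => by simp only [Language.Formula.realize_iExs, hφ]; rfl⟩

theorem forall_elem {R : ∀ (M : Type u) [Group M], (α → M) → M → Prop}
    (hR : GroupDefinable fun M _ (w : α ⊕ Unit → M) =>
      R M (fun a => w (Sum.inl a)) (w (Sum.inr ()))) :
    GroupDefinable fun M _ v => ∀ x, R M v x := by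
  obtain ⟨φ, hφ⟩ := forall_tuple (R := fun M _ v (x : Unit → M) => R M v (x ())) hR
  exact ⟨φ, fun M _ v => (hφ M v).trans ⟨fun h x => h fun _ => x, fun h x => h (x ())⟩⟩

theorem exists_elem {R : ∀ (M : Type u) [Group M], (α → M) → M → Prop}
    (hR : GroupDefinable fun M _ (w : α ⊕ Unit → M) =>
      R M (fun a => w (Sum.inl a)) (w (Sum.inr ()))) :
    GroupDefinable fun M _ v => ∃ x, R M v x := by
  obtain ⟨φ, hφ⟩ := exists_tuple (R := fun M _ v (x : Unit → M) => R M v (x ())) hR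
  exact ⟨φ, fun M _ v => (hφ M v).trans
    ⟨fun ⟨x, h⟩ => ⟨x (), h⟩, fun ⟨x, h⟩ => ⟨fun _ => x, h⟩⟩⟩

theorem transfer {P : ∀ (M : Type u) [Group M], Prop}
    (hP : GroupDefinable fun M _ (_ : Empty → M) => P M) {G H : Type u} [Group G] [Group H]
    (h : GroupElemEquiv G H) : P G ↔ P H := by
  obtain ⟨φ, hφ⟩ := hP
  exact (hφ G default).symm.trans
    ((Language.ElementarilyEquivalent.realize_sentence h φ).trans (hφ H default))

end GroupDefinable

/-! ### Uniform terms in the language of rings -/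

/-- `f` is given, uniformly in all fields, by a term of the language of rings. -/
def RingTerm {α : Type} (f : ∀ (F : Type u) [Field F], (α → F) → F) : Prop :=
  ∃ t : Language.ring.Term α, ∀ (F : Type u) [Field F] (v : α → F),
    letI := Ring.compatibleRingOfRing F
    t.realize v = f F v

namespace RingTerm

variable {α : Type} {f g : ∀ (F : Type u) [Field F], (α → F) → F}

theorem var (a : α) : RingTerm.{u} fun _ _ v => v a :=
  ⟨Language.Term.var a, fun _ _ _ => rfl⟩

theorem zero : RingTerm.{u} fun F _ (_ : α → F) => 0 :=
  ⟨0, fun F _ v => by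
    letI := Ring.compatibleRingOfRing F
    exact Ring.realize_zero v⟩

theorem one : RingTerm.{u} fun F _ (_ : α → F) => 1 :=
  ⟨1, fun F _ v => by
    letI := Ring.compatibleRingOfRing F
    exact Ring.realize_one v⟩

theorem neg (hf : RingTerm f) : RingTerm fun F _ v => -f F v := by
  obtain ⟨s, hs⟩ := hf
  refine ⟨-s, fun F _ v => ?_⟩
  letI := Ring.compatibleRingOfRing F
  exact (Ring.realize_neg s v).trans (by rw [hs])

theorem add (hf : RingTerm f) (hg : RingTerm g) : RingTerm fun F _ v => f F v + g F v := by
  obtain ⟨s, hs⟩ := hf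
  obtain ⟨t, ht⟩ := hg
  refine ⟨s + t, fun F _ v => ?_⟩
  letI := Ring.compatibleRingOfRing F
  exact (Ring.realize_add s t v).trans (by rw [hs, ht])

theorem mul (hf : RingTerm f) (hg : RingTerm g) : RingTerm fun F _ v => f F v * g F v := by
  obtain ⟨s, hs⟩ := hf
  obtain ⟨t, ht⟩ := hg
  refine ⟨s * t, fun F _ v => ?_⟩
  letI := Ring.compatibleRingOfRing F
  exact (Ring.realize_mul s t v).trans (by rw [hs, ht])

theorem ite (p : Prop) [Decidable p] (hf : RingTerm f) (hg : RingTerm g) :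
    RingTerm fun F _ v => if p then f F v else g F v := by
  by_cases hp : p
  · simpa only [hp, if_true] using hf
  · simpa only [hp, if_false] using hg

theorem sum {κ : Type} (s : Finset κ) {h : κ → ∀ (F : Type u) [Field F], (α → F) → F}
    (hh : ∀ k, RingTerm (h k)) : RingTerm fun F _ v => ∑ k ∈ s, h k F v := by
  classical
  induction s using Finset.induction_on with
  | empty => simpa only [Finset.sum_empty] using zero
  | insert k s hk ih => simpa only [Finset.sum_insert hk] using (hh k).add ih

theorem prod {κ : Type} (s : Finset κ) {h : κ → ∀ (F : Type u) [Field F], (α → F) → F}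
    (hh : ∀ k, RingTerm (h k)) : RingTerm fun F _ v => ∏ k ∈ s, h k F v := by
  classical
  induction s using Finset.induction_on with
  | empty => simpa only [Finset.prod_empty] using one
  | insert k s hk ih => simpa only [Finset.prod_insert hk] using (hh k).mul ih

variable {n : ℕ} {A B : ∀ (F : Type u) [Field F], (α → F) → Matrix (Fin n) (Fin n) F}

theorem matrix_mul (hA : ∀ i j, RingTerm fun F _ v => A F v i j)
    (hB : ∀ i j, RingTerm fun F _ v => B F v i j) (i j : Fin n) :
    RingTerm fun F _ v => (A F v * B F v) i j := by
  simpa only [Matrix.mul_apply] using sum Finset.univ fun k => (hA i k).mul (hB k j)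

theorem matrix_one (i j : Fin n) :
    RingTerm fun F _ (_ : α → F) => (1 : Matrix (Fin n) (Fin n) F) i j := by
  simpa only [Matrix.one_apply] using ite (i = j) one zero

theorem matrix_listProd {κ : Type} (l : List κ)
    {C : κ → ∀ (F : Type u) [Field F], (α → F) → Matrix (Fin n) (Fin n) F}
    (hC : ∀ k i j, RingTerm fun F _ v => C k F v i j) (i j : Fin n) :
    RingTerm fun F _ v => (l.map fun k => C k F v).prod i j := by
  induction l generalizing i j with
  | nil => exact matrix_one i j
  | cons k l ih =>
    simp only [List.map_cons, List.prod_cons]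
    exact matrix_mul (hC k) ih i j

theorem matrix_det (hA : ∀ i j, RingTerm fun F _ v => A F v i j) :
    RingTerm fun F _ v => (A F v).det := by
  simp only [Matrix.det_apply]
  refine sum Finset.univ fun σ => ?_
  have h := prod Finset.univ fun i => hA (σ i) i
  rcases Int.units_eq_one_or (Equiv.Perm.sign σ) with hσ | hσ
  · simpa only [hσ, one_smul] using h
  · simpa only [hσ, Units.neg_smul, one_smul] using h.neg

theorem matrix_adjugate (hA : ∀ i j, RingTerm fun F _ v => A F v i j) (i j : Fin n) :
    RingTerm fun F _ v => (A F v).adjugate i j := by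
  simp only [Matrix.adjugate_apply]
  refine matrix_det fun k l => ?_
  simp only [Matrix.updateRow_apply, Pi.single_apply]
  exact ite (k = j) (ite (l = i) one zero) (hA k l)

theorem exists_eq_formula (hf : RingTerm f) (hg : RingTerm g) :
    ∃ φ : Language.ring.Formula α, ∀ (F : Type u) [Field F] (v : α → F),
      letI := Ring.compatibleRingOfRing F
      φ.Realize v ↔ f F v = g F v := by
  obtain ⟨s, hs⟩ := hf
  obtain ⟨t, ht⟩ := hg
  refine ⟨s.equal t, fun F _ v => ?_⟩
  letI := Ring.compatibleRingOfRing F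
  exact Language.Formula.realize_equal.trans (by rw [hs, ht])

theorem exists_matrix_eq_formula (hA : ∀ i j, RingTerm fun F _ v => A F v i j)
    (hB : ∀ i j, RingTerm fun F _ v => B F v i j) :
    ∃ φ : Language.ring.Formula α, ∀ (F : Type u) [Field F] (v : α → F),
      letI := Ring.compatibleRingOfRing F
      φ.Realize v ↔ A F v = B F v := by
  choose φ hφ using fun q : Fin n × Fin n => (hA q.1 q.2).exists_eq_formula (hB q.1 q.2)
  refine ⟨Language.Formula.iInf φ, fun F _ v => ?_⟩
  letI := Ring.compatibleRingOfRing F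
  rw [Language.Formula.realize_iInf, ← Matrix.ext_iff]
  exact ⟨fun h i j => (hφ (i, j) F v).1 (h (i, j)), fun h q => (hφ q F v).2 (h q.1 q.2)⟩

end RingTerm

/-! ### Fields living on a subset of a group -/

section FieldLine

variable {M : Type*} [Group M]

/-- `y` lies in the double centralizer of `X`. -/
def InBicentralizer (X y : M) : Prop := ∀ g, g * X = X * g → y * g = g * y

/-- The elements of the double centralizer of `X` which are trivial or conjugate to `X`. -/
def lineSet (X : M) : Set M :=
  {t | InBicentralizer X t ∧ (t = 1 ∨ ∃ g, t = g * X * g⁻¹)}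

/-- The product of `x` and `y` given by the commutator of a conjugate of `x` by `P` and a
conjugate of `y` by `Q`. -/
def lineMul (P Q x y : M) : M :=
  (P * x * P⁻¹) * (Q * y * Q⁻¹) * (P * x * P⁻¹)⁻¹ * (Q * y * Q⁻¹)⁻¹

/-- The set `lineSet X` is a field of characteristic not two, with addition the group
multiplication, multiplication `lineMul P Q` and unit `X`, and it exhausts the double centralizer
of `X` up to central factors. -/
structure IsFieldLine (X P Q : M) : Prop where
  mul_mem : ∀ x, x ∈ lineSet X → ∀ y, y ∈ lineSet X → x * y ∈ lineSet X
  inv_mem : ∀ x, x ∈ lineSet X → x⁻¹ ∈ lineSet X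
  mul_comm : ∀ x, x ∈ lineSet X → ∀ y, y ∈ lineSet X → x * y = y * x
  sq_ne_one : X * X ≠ 1
  lineMul_mem : ∀ x, x ∈ lineSet X → ∀ y, y ∈ lineSet X → lineMul P Q x y ∈ lineSet X
  lineMul_comm : ∀ x, x ∈ lineSet X → ∀ y, y ∈ lineSet X → lineMul P Q x y = lineMul P Q y x
  lineMul_assoc : ∀ x, x ∈ lineSet X → ∀ y, y ∈ lineSet X → ∀ z, z ∈ lineSet X →
    lineMul P Q (lineMul P Q x y) z = lineMul P Q x (lineMul P Q y z)
  lineMul_mul : ∀ x, x ∈ lineSet X → ∀ y, y ∈ lineSet X → ∀ z, z ∈ lineSet X →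
    lineMul P Q x (y * z) = lineMul P Q x y * lineMul P Q x z
  one_lineMul : ∀ x, x ∈ lineSet X → lineMul P Q X x = x
  exists_inv : ∀ x, x ∈ lineSet X → x ≠ 1 → ∃ y, y ∈ lineSet X ∧ lineMul P Q x y = X
  exists_center : ∀ y, InBicentralizer X y →
    ∃ z, (∀ g, g * z = z * g) ∧ ∃ t, t ∈ lineSet X ∧ y = z * t

theorem one_mem_lineSet (X : M) : 1 ∈ lineSet X :=
  ⟨fun g _ => by simp, Or.inl rfl⟩

theorem self_mem_lineSet (X : M) : X ∈ lineSet X :=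
  ⟨fun _ h => h.symm, Or.inr ⟨1, by simp⟩⟩

theorem IsFieldLine.ne_one {X P Q : M} (h : IsFieldLine X P Q) : X ≠ 1 := by
  intro hX
  exact h.sq_ne_one (by rw [hX, mul_one])

open Classical in
/-- The field structure on `lineSet X`. -/
@[reducible] noncomputable def IsFieldLine.field {X P Q : M} (h : IsFieldLine X P Q) :
    Field (lineSet X) :=
  let _ : Add (lineSet X) := ⟨fun x y => ⟨x * y, h.mul_mem _ x.2 _ y.2⟩⟩
  let _ : Mul (lineSet X) := ⟨fun x y => ⟨lineMul P Q x y, h.lineMul_mem _ x.2 _ y.2⟩⟩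
  let _ : Neg (lineSet X) := ⟨fun x => ⟨x.1⁻¹, h.inv_mem _ x.2⟩⟩
  let _ : Zero (lineSet X) := ⟨⟨1, one_mem_lineSet X⟩⟩
  let _ : One (lineSet X) := ⟨⟨X, self_mem_lineSet X⟩⟩
  let _ : Inv (lineSet X) := ⟨fun x => if hx : x.1 = 1 then 0 else
    ⟨(h.exists_inv _ x.2 hx).choose, (h.exists_inv _ x.2 hx).choose_spec.1⟩⟩
  Field.ofMinimalAxioms (lineSet X)
    (fun _ _ _ => Subtype.ext (mul_assoc _ _ _))
    (fun _ => Subtype.ext (one_mul _))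
    (fun _ => Subtype.ext (inv_mul_cancel _))
    (fun x y z => Subtype.ext (h.lineMul_assoc _ x.2 _ y.2 _ z.2))
    (fun x y => Subtype.ext (h.lineMul_comm _ x.2 _ y.2))
    (fun x => Subtype.ext (h.one_lineMul _ x.2))
    (fun x hx => by
      have hx' : x.1 ≠ 1 := fun h' => hx (Subtype.ext h')
      refine Subtype.ext ?_
      change lineMul P Q x.1 (if hx : x.1 = 1 then (0 : lineSet X) else
        ⟨(h.exists_inv _ x.2 hx).choose, (h.exists_inv _ x.2 hx).choose_spec.1⟩ : lineSet X) = X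
      rw [dif_neg hx']
      exact (h.exists_inv _ x.2 hx').choose_spec.2)
    (dif_pos rfl)
    (fun x y z => Subtype.ext (h.lineMul_mul _ x.2 _ y.2 _ z.2))
    ⟨⟨X, self_mem_lineSet X⟩, ⟨1, one_mem_lineSet X⟩, fun h' => h.ne_one (congrArg Subtype.val h')⟩

end FieldLine

/-! ### Field lines in general linear groups -/

section GLLine

open Matrix Polynomial

variable {F : Type*} [Field F] {n : ℕ}

/-- Only eigenvalues are excluded. This lets invertible matrices stand in for arbitrary ones:
commuting with `t - A` is commuting with `A`. -/
theorem infinite_isUnit_smul_one_sub [Infinite F] (A : Matrix (Fin n) (Fin n) F) :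
    {t : F | IsUnit (t • (1 : Matrix (Fin n) (Fin n) F) - A)}.Infinite := by
  have h : {t : F | A.charpoly.IsRoot t}.Finite :=
    Polynomial.finite_setOfPred_isRoot A.charpoly_monic.ne_zero
  refine h.infinite_compl.mono fun t ht => ?_
  simp only [Set.mem_compl_iff, Set.mem_ofPred_eq, IsRoot.def, eval_charpoly] at ht
  rw [Set.mem_ofPred_eq, isUnit_iff_isUnit_det, isUnit_iff_ne_zero, smul_one_eq_diagonal]
  exact ht

/-- A matrix commuting with all invertible matrices commuting with `N`, where `N ^ 2 = 0`,
is a linear combination of `1` and `N`. -/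
theorem exists_eq_smul_one_add_smul [Infinite F] {N y : Matrix (Fin n) (Fin n) F}
    (hN : N * N = 0) (hN' : N ≠ 0)
    (hy : ∀ g : GL (Fin n) F, g.val * N = N * g.val → y * g.val = g.val * y) :
    ∃ a b : F, y = a • (1 : Matrix (Fin n) (Fin n) F) + b • N := by
  -- Since `N ^ 2 = 0`, the matrix `A N + N A` commutes with `N`; subtracting it from a suitable
  -- scalar gives an invertible matrix to which `hy` applies.
  have hZ : ∀ A : Matrix (Fin n) (Fin n) F, y * (A * N + N * A) = (A * N + N * A) * y := by
    intro A
    obtain ⟨t, ht⟩ := (infinite_isUnit_smul_one_sub (A * N + N * A)).nonempty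
    have h := hy ht.unit (by
      simp only [IsUnit.unit_spec, sub_mul, mul_sub, smul_mul_assoc, mul_smul_comm, one_mul,
        mul_one, add_mul, mul_add]
      rw [mul_assoc A N N, hN, ← mul_assoc N N A, hN]
      simp [mul_assoc])
    simp only [IsUnit.unit_spec, sub_mul, mul_sub, smul_mul_assoc, mul_smul_comm, one_mul,
      mul_one] at h
    exact sub_right_injective h
  obtain ⟨p, q, hpq⟩ : ∃ p q, N p q ≠ 0 := by
    by_contra! h
    exact hN' (Matrix.ext h)
  set δ : F := if q = p then 1 else 0 with hδ
  -- Column `q` of the identity `hZ` for the matrix units `E_{kp}`, assembled over all `k`.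
  have h₁ : y * (N p q • (1 : Matrix (Fin n) (Fin n) F) + δ • N) =
      (N * y) p q • (1 : Matrix (Fin n) (Fin n) F) + y p q • N := by
    ext i k
    have h := congrFun (congrFun (hZ (Matrix.single k p 1)) i) q
    have e₁ : (y * (Matrix.single k p (1 : F) * N + N * Matrix.single k p (1 : F)) :
        Matrix (Fin n) (Fin n) F) i q =
        y i k * N p q + δ * (y * N) i k := by
      rw [mul_add, ← mul_assoc, ← mul_assoc, Matrix.add_apply, Matrix.mul_apply]
      by_cases hqp : q = p
      · subst hqp; simp [Matrix.mul_apply, Matrix.single_apply, hδ, ite_and]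
      · simp [Matrix.mul_apply, Matrix.single_apply, hδ, ite_and, hqp, Ne.symm hqp]
    have e₂ : ((Matrix.single k p (1 : F) * N + N * Matrix.single k p (1 : F)) * y :
        Matrix (Fin n) (Fin n) F) i q =
        (if i = k then (N * y) p q else 0) + N i k * y p q := by
      rw [add_mul, Matrix.add_apply, mul_assoc, mul_assoc]
      congr 1
      · simp [Matrix.mul_apply, Matrix.single_apply, ite_and, eq_comm]
      · simp [Matrix.mul_apply, Matrix.single_apply, ite_and]
    rw [e₁, e₂] at h
    simp only [mul_add, Matrix.add_apply, mul_smul_comm, mul_one, Matrix.smul_apply, smul_eq_mul,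
      Matrix.one_apply, mul_ite, mul_zero]
    linear_combination h
  have h₂ : (N p q * N p q) • y =
      ((N * y) p q * N p q) • (1 : Matrix (Fin n) (Fin n) F) +
        (y p q * N p q - (N * y) p q * δ) • N := by
    -- Because `N ^ 2 = 0`, this factor inverts `N p q + δ N` up to the scalar `(N p q) ^ 2`.
    have h := congrArg (· * (N p q • (1 : Matrix (Fin n) (Fin n) F) - δ • N)) h₁
    simp only [mul_assoc, mul_sub, mul_add, add_mul, mul_smul_comm, smul_mul_assoc, mul_one,
      one_mul, hN, mul_zero, smul_zero, add_zero, sub_zero] at h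
    have h' : (N p q * N p q) • y = N p q • N p q • y := by rw [smul_smul]
    rw [h']
    refine Eq.trans ?_ (h.trans ?_)
    · module
    · module
  have h₃ : N p q * N p q ≠ 0 := mul_ne_zero hpq hpq
  refine ⟨(N p q * N p q)⁻¹ * ((N * y) p q * N p q),
    (N p q * N p q)⁻¹ * (y p q * N p q - (N * y) p q * δ), ?_⟩
  rw [mul_smul _ _ (1 : Matrix (Fin n) (Fin n) F), mul_smul _ _ N, ← smul_add, ← h₂, smul_smul, inv_mul_cancel₀ h₃, one_smul]

/-- If every invertible matrix commuting with the centralizer of `X` is scalar or conjugate to a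
multiple of `X`, then `X` is the sum of a scalar and a matrix of square zero. -/
theorem exists_eq_smul_one_add_sq_zero [CharZero F] (hn : 0 < n) (X : GL (Fin n) F)
    (hX : ∀ a : F, X.val ≠ a • (1 : Matrix (Fin n) (Fin n) F))
    (key : ∀ Y : Matrix (Fin n) (Fin n) F, IsUnit Y →
      (∀ A : Matrix (Fin n) (Fin n) F, A * X.val = X * A → Y * A = A * Y) →
      ∃ c : F, Y = c • (1 : Matrix (Fin n) (Fin n) F) ∨ ∃ g : GL (Fin n) F,
        Y = c • (g.val * X.val * g⁻¹.val)) :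
    ∃ (μ : F) (N : Matrix (Fin n) (Fin n) F), N * N = 0 ∧ N ≠ 0 ∧
      X.val = μ • (1 : Matrix (Fin n) (Fin n) F) + N := by
  have hn0 : (n : F) ≠ 0 := Nat.cast_ne_zero.2 hn.ne'
  set x : Matrix (Fin n) (Fin n) F := X.val with hx
  set τ := x.trace with hτ
  have tr1 : ∀ t : F, (t • (1 : Matrix (Fin n) (Fin n) F)).trace = n * t := by
    intro t; simp [mul_comm]
  -- Since `t - x` is never scalar, it must be conjugate to `c x`; trace and determinant then
  -- express its determinant through `t`.
  have hlin : ∀ t : F, IsUnit (t • (1 : Matrix (Fin n) (Fin n) F) - x) →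
      ∃ c, n * t - τ = c * τ ∧ (t • (1 : Matrix (Fin n) (Fin n) F) - x).det = c ^ n * x.det := by
    intro t ht
    obtain ⟨c, hc | ⟨g, hg⟩⟩ := key _ ht (fun A hA => by
      simp only [sub_mul, mul_sub, smul_mul_assoc, mul_smul_comm, one_mul, mul_one, hA])
    · refine (hX (t - c) ?_).elim
      rw [sub_smul, ← hc, sub_sub_cancel]
    · refine ⟨c, ?_, ?_⟩
      · have := congrArg Matrix.trace hg
        rwa [trace_sub, tr1, trace_smul, trace_units_conj, smul_eq_mul] at this
      · rw [hg, det_smul, det_units_conj, Fintype.card_fin]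
  have hτ0 : τ ≠ 0 := by
    intro h0
    obtain ⟨t, ht, ht0⟩ := (infinite_isUnit_smul_one_sub x).exists_notMem_finset {0}
    obtain ⟨c, hc, -⟩ := hlin t ht
    rw [h0, mul_zero, sub_zero] at hc
    exact ht0 (by simpa [hn0] using hc)
  have hdet : x.det ≠ 0 := by
    have := X.isUnit
    rw [isUnit_iff_isUnit_det, isUnit_iff_ne_zero] at this
    exact this
  -- The characteristic polynomial is thus proportional to `(n X - τ) ^ n`: the only eigenvalue is
  -- `τ / n`, and Cayley–Hamilton makes `x - τ / n` nilpotent.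
  have hpoly : C (τ ^ n) * x.charpoly =
      C x.det * (C (n : F) * (Polynomial.X : F[X]) - C τ) ^ n := by
    refine eq_of_infinite_eval_eq _ _ ((infinite_isUnit_smul_one_sub x).mono fun t ht => ?_)
    obtain ⟨c, hc, hc'⟩ := hlin t ht
    have : (scalar (Fin n)) t - x = t • (1 : Matrix (Fin n) (Fin n) F) - x := by
      rw [smul_one_eq_diagonal]; rfl
    simp only [Set.mem_ofPred_eq, eval_mul, eval_C, eval_charpoly, eval_pow, eval_sub, eval_X,
      this, hc', hc]
    ring
  have hnil : (n • x - τ • (1 : Matrix (Fin n) (Fin n) F)) ^ n = 0 := by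
    have h := congrArg (aeval x) hpoly
    rw [map_mul, aeval_self_charpoly, mul_zero, map_mul, map_pow, map_sub, map_mul, aeval_C,
      aeval_C, aeval_C, aeval_X, Algebra.algebraMap_eq_smul_one, smul_mul_assoc, one_mul] at h
    have h' := (smul_eq_zero.1 h.symm).resolve_left hdet
    rw [← h']
    congr 1
    rw [Algebra.algebraMap_eq_smul_one, Algebra.algebraMap_eq_smul_one, smul_mul_assoc, one_mul,
      Nat.cast_smul_eq_nsmul]
  set μ := τ / n with hμ
  set N := x - μ • (1 : Matrix (Fin n) (Fin n) F) with hNdef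
  have hxN : x = μ • (1 : Matrix (Fin n) (Fin n) F) + N := by rw [hNdef]; abel
  have hNnil : IsNilpotent N := by
    refine ⟨n, ?_⟩
    have : N = (n : F)⁻¹ • (n • x - τ • (1 : Matrix (Fin n) (Fin n) F)) := by
      rw [smul_sub, smul_smul, ← Nat.cast_smul_eq_nsmul F n x, smul_smul, inv_mul_cancel₀ hn0,
        one_smul, hNdef, hμ, div_eq_inv_mul]
    rw [this, _root_.smul_pow, hnil, smul_zero]
  have hN0 : N ≠ 0 := fun h => hX μ (by rw [hxN, h, add_zero])
  have hcomm : ∀ A : Matrix (Fin n) (Fin n) F, A * x = x * A → A * N = N * A := by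
    intro A hA
    simp only [hNdef, sub_mul, mul_sub, smul_mul_assoc, mul_smul_comm, one_mul, mul_one, hA]
  have hNN : IsNilpotent (N * N) := (Commute.refl N).isNilpotent_mul_left hNnil
  have hnu : IsUnit (1 + N * N) := hNN.isUnit_one_add
  refine ⟨μ, N, ?_, hN0, hxN⟩
  have htrN : ∀ A : Matrix (Fin n) (Fin n) F, IsNilpotent A → A.trace = 0 :=
    fun A hA => (isNilpotent_trace_of_isNilpotent hA).eq_zero
  -- The test matrix `1 + N ^ 2` is unipotent. If it is scalar, its trace forces `N ^ 2 = 0`.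
  -- Otherwise `N ^ 2` is conjugate to a nonzero multiple of `N`, which is impossible for a nonzero
  -- nilpotent `N`.
  obtain ⟨c, hc | ⟨g, hg⟩⟩ := key _ hnu (fun A hA => by
    rw [add_mul, mul_add, one_mul, mul_one, mul_assoc, ← hcomm A hA, ← mul_assoc, ← hcomm A hA,
      mul_assoc])
  · have h := congrArg Matrix.trace hc
    rw [trace_add, htrN _ hNN, tr1, trace_one, Fintype.card_fin, add_zero] at h
    have hc1 : c = 1 := (mul_left_cancel₀ hn0 ((mul_one _).trans h)).symm
    rwa [hc1, one_smul, add_eq_left] at hc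
  · exfalso
    have hμ0 : (n : F) * μ = τ := by rw [hμ]; field_simp
    have h := congrArg Matrix.trace hg
    rw [trace_add, htrN _ hNN, trace_smul, trace_units_conj, trace_one, Fintype.card_fin, add_zero,
      ← hτ, ← hμ0, smul_eq_mul] at h
    have hcμ : c * μ = 1 := by
      apply mul_left_cancel₀ hn0
      rw [mul_one]
      linear_combination -h
    have hc0 : c ≠ 0 := left_ne_zero_of_mul_eq_one hcμ
    have hconj : N * N = g.val * (c • N) * g⁻¹.val := by
      rw [hxN, mul_add, add_mul, mul_smul_comm, mul_one, smul_mul_assoc, Units.mul_inv, smul_add,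
        smul_smul, hcμ, one_smul] at hg
      rw [add_left_cancel hg, mul_smul_comm, smul_mul_assoc]
    -- Conjugacy of `N ^ 2` with `c N` halves any vanishing exponent; starting from a power of two
    -- this descends to `N = 0`.
    have hdown : ∀ j : ℕ, N ^ (2 * j) = 0 → N ^ j = 0 := by
      intro j hj
      have hpow : ∀ j : ℕ, (N * N) ^ j =
          g.val * (c • N) ^ j * g⁻¹.val := by
        intro j
        rw [hconj]
        exact Units.conj_pow g (c • N) j
      have h := hpow j
      rw [← pow_two, ← pow_mul, hj, _root_.smul_pow] at h
      have h' : g⁻¹.val * (0 : Matrix (Fin n) (Fin n) F) * g.val = c ^ j • N ^ j := by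
        rw [h]
        simp [mul_assoc]
      rw [mul_zero, zero_mul] at h'
      exact (smul_eq_zero.1 h'.symm).resolve_left (pow_ne_zero _ hc0)
    have hall : ∀ k : ℕ, N ^ (2 ^ k) = 0 → N = 0 := by
      intro k
      induction k with
      | zero => intro h; simpa using h
      | succ k ih => intro h; exact ih (hdown _ (by rwa [pow_succ, mul_comm] at h))
    obtain ⟨m, hm⟩ := hNnil
    exact hN0 (hall m (pow_eq_zero_of_le Nat.lt_two_pow_self.le hm))

end GLLine

/-! ### Field lines as groups of unipotents with square-zero direction -/

section GLLine

open Matrix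

variable {F : Type*} [Field F] {n : ℕ}

theorem GL_central_iff_exists_smul_one {z : GL (Fin n) F} :
    (∀ g, g * z = z * g) ↔ ∃ c : F, z.val = c • (1 : Matrix (Fin n) (Fin n) F) := by
  rw [← Subgroup.mem_center_iff, GeneralLinearGroup.mem_center_iff_val_mem_range_scalar]
  refine exists_congr fun c => ?_
  rw [smul_one_eq_diagonal, eq_comm]
  rfl

theorem trace_smul_one_add_smul [CharZero F] {N : Matrix (Fin n) (Fin n) F} (hN : N * N = 0)
    (a b : F) : (a • (1 : Matrix (Fin n) (Fin n) F) + b • N).trace = n * a := by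
  have h : N.trace = 0 := (isNilpotent_trace_of_isNilpotent ⟨2, by rw [pow_two, hN]⟩).eq_zero
  simp [h, mul_comm]

/-- Elements of the double centralizer lie in the span of `1` and `N`. As `N` has trace zero, the
trace determines the scalar part, and conjugation preserves the trace. -/
theorem exists_val_eq_of_inBicentralizer [CharZero F] (hn : 0 < n) {X t : GL (Fin n) F}
    {N : Matrix (Fin n) (Fin n) F} {μ : F} (hN : N * N = 0) (hN0 : N ≠ 0)
    (hX : X.val = μ • (1 : Matrix (Fin n) (Fin n) F) + N) (ht : InBicentralizer X t) :
    ∃ a b : F, t.val = a • (1 : Matrix (Fin n) (Fin n) F) + b • N ∧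
      (∀ g : GL (Fin n) F, t = g * X * g⁻¹ → a = μ) := by
  have hn0 : (n : F) ≠ 0 := Nat.cast_ne_zero.2 hn.ne'
  obtain ⟨a, b, hab⟩ := exists_eq_smul_one_add_smul hN hN0 (y := t.val) fun g hg => by
    refine congrArg Units.val (ht g (Units.ext ?_))
    rw [Units.val_mul, Units.val_mul, hX, mul_add, add_mul, hg]
    simp
  refine ⟨a, b, hab, ?_⟩
  rintro g hg
  have h := congrArg (fun y : GL (Fin n) F => y.val.trace) hg
  simp only [Units.val_mul, trace_units_conj] at h
  have hX' : X.val = μ • (1 : Matrix (Fin n) (Fin n) F) + (1 : F) • N := by rw [hX, one_smul]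
  rw [hab, hX', trace_smul_one_add_smul hN, trace_smul_one_add_smul hN] at h
  exact mul_left_cancel₀ hn0 h

/-- The unipotent matrix `1 + b N`, where `N ^ 2 = 0`. -/
def sqZeroUnipotent {N : Matrix (Fin n) (Fin n) F} (hN : N * N = 0) (b : F) : GL (Fin n) F where
  val := 1 + b • N
  inv := 1 - b • N
  val_inv := by
    simp only [add_mul, mul_sub, one_mul, mul_one, smul_mul_assoc, mul_smul_comm, hN]; simp
  inv_val := by
    simp only [sub_mul, mul_add, one_mul, mul_one, smul_mul_assoc, mul_smul_comm, hN]; simp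

theorem sqZeroUnipotent_mul {N : Matrix (Fin n) (Fin n) F} (hN : N * N = 0) (a b : F) :
    sqZeroUnipotent hN a * sqZeroUnipotent hN b = sqZeroUnipotent hN (a + b) := by
  refine Units.ext ?_
  change (1 + a • N) * (1 + b • N) = 1 + (a + b) • N
  simp only [add_mul, mul_add, one_mul, mul_one, smul_mul_assoc, mul_smul_comm, hN, smul_zero,
    add_zero, add_smul]
  abel

theorem sqZeroUnipotent_injective {N : Matrix (Fin n) (Fin n) F} (hN : N * N = 0) (hN0 : N ≠ 0) :
    Function.Injective (sqZeroUnipotent hN) := by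
  intro a b h
  have h' : (1 : Matrix (Fin n) (Fin n) F) + a • N = 1 + b • N := congrArg Units.val h
  have h'' := add_left_cancel h'
  rw [← sub_eq_zero, ← sub_smul, smul_eq_zero, or_iff_left hN0, sub_eq_zero] at h''
  exact h''

/-- A field line in a general linear group consists of the matrices `1 + b N`, for some nonzero
matrix `N` of square zero. -/
theorem IsFieldLine.exists_sqZero [CharZero F] (hn : 0 < n) {X P Q : GL (Fin n) F}
    (h : IsFieldLine X P Q) :
    ∃ (N : Matrix (Fin n) (Fin n) F) (hN : N * N = 0), N ≠ 0 ∧ X = sqZeroUnipotent hN 1 ∧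
      ∀ t, t ∈ lineSet X ↔ ∃ b, t = sqZeroUnipotent hN b := by
  have hn0 : (n : F) ≠ 0 := Nat.cast_ne_zero.2 hn.ne'
  have hXX : X * X ∈ lineSet X := h.mul_mem _ (self_mem_lineSet X) _ (self_mem_lineSet X)
  -- `X ^ 2` is a nontrivial element of the line, hence conjugate to `X`. This excludes scalar `X`,
  -- and later gives `μ ^ 2 = μ` for the scalar part.
  obtain ⟨g₀, hg₀⟩ := hXX.2.resolve_left h.sq_ne_one
  have hXs : ∀ a : F, X.val ≠ a • (1 : Matrix (Fin n) (Fin n) F) := by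
    intro a ha
    have hc := GL_central_iff_exists_smul_one.2 ⟨a, ha⟩
    rw [hc g₀, mul_inv_cancel_right, mul_eq_right] at hg₀
    exact h.ne_one hg₀
  obtain ⟨μ, N, hN, hN0, hX⟩ := exists_eq_smul_one_add_sq_zero hn X hXs (by
    intro Y hY hcomm
    obtain ⟨z, hz, t, ht, hzt⟩ := h.exists_center hY.unit fun g hg => Units.ext
      (hcomm g.val (congrArg Units.val hg))
    obtain ⟨c, hc⟩ := GL_central_iff_exists_smul_one.1 hz
    have hY' : Y = c • t.val := by
      have := congrArg Units.val hzt
      rwa [IsUnit.unit_spec, Units.val_mul, hc, smul_mul_assoc, one_mul] at this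
    refine ⟨c, ?_⟩
    rcases ht.2 with rfl | ⟨g, rfl⟩
    · exact Or.inl hY'
    · exact Or.inr ⟨g, hY'⟩)
  have hμ : μ = 1 := by
    have h2 : (X * X).val = (μ * μ) • (1 : Matrix (Fin n) (Fin n) F) + (2 * μ) • N := by
      rw [Units.val_mul, hX]
      simp only [add_mul, mul_add, one_mul, mul_one, smul_mul_assoc, mul_smul_comm, hN]
      module
    obtain ⟨a, b, hab, ha⟩ := exists_val_eq_of_inBicentralizer hn hN hN0 hX hXX.1
    have haμ := ha g₀ hg₀
    rw [h2] at hab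
    have ht := congrArg Matrix.trace hab
    rw [trace_smul_one_add_smul hN, trace_smul_one_add_smul hN, haμ] at ht
    have hμμ := mul_left_cancel₀ hn0 ht
    refine mul_left_cancel₀ (fun h0 : μ = 0 => ?_) (hμμ.trans (mul_one μ).symm)
    rw [h0, zero_smul, zero_add] at hX
    have hx : X.val * X.val = 0 := by rw [hX, hN]
    exact hN0 (by rw [← hX]; exact X.isUnit.mul_left_eq_zero.1 hx)
  subst hμ
  refine ⟨N, hN, hN0, Units.ext ?_, fun t => ⟨fun ht => ?_, ?_⟩⟩
  · rw [hX, one_smul]; change 1 + N = 1 + (1 : F) • N; rw [one_smul]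
  · obtain ⟨a, b, hab, ha⟩ := exists_val_eq_of_inBicentralizer hn hN hN0 hX ht.1
    rcases ht.2 with rfl | ⟨g, hg⟩
    · refine ⟨0, Units.ext ?_⟩
      change (1 : Matrix (Fin n) (Fin n) F) = 1 + (0 : F) • N
      simp
    · refine ⟨b, Units.ext ?_⟩
      rw [hab, ha g hg, one_smul]
      rfl
  · rintro ⟨b, rfl⟩
    have hbic : InBicentralizer X (sqZeroUnipotent hN b) := by
      intro g hg
      have hg' := congrArg Units.val hg
      rw [Units.val_mul, Units.val_mul, hX, one_smul, mul_add, add_mul, mul_one, one_mul] at hg'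
      refine Units.ext ?_
      change (1 + b • N) * g.val = g.val * (1 + b • N)
      rw [mul_add, add_mul, mul_one, one_mul, smul_mul_assoc, mul_smul_comm, add_left_cancel hg']
    -- A priori `1 + b N` lies in the line only up to a central factor; both it and `t` have trace
    -- `n`, so this factor is `1`.
    obtain ⟨z, hz, t, ht, hzt⟩ := h.exists_center _ hbic
    obtain ⟨c, hc⟩ := GL_central_iff_exists_smul_one.1 hz
    obtain ⟨a, b', hab, ha⟩ := exists_val_eq_of_inBicentralizer hn hN hN0 hX ht.1
    have hT : t.val.trace = n := by
      rcases ht.2 with rfl | ⟨g, hg⟩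
      · simp
      · rw [hab, ha g hg, trace_smul_one_add_smul hN, mul_one]
    have h1 := congrArg (fun y : GL (Fin n) F => y.val.trace) hzt
    have h2 : (sqZeroUnipotent hN b).val.trace = n := by
      have := trace_smul_one_add_smul hN (1 : F) b
      rwa [one_smul, mul_one] at this
    simp only [Units.val_mul, hc, smul_mul_assoc, one_mul, trace_smul, hT, h2, smul_eq_mul] at h1
    have hc1 : c = 1 := mul_right_cancel₀ hn0 (h1.symm.trans (one_mul _).symm)
    have hz1 : z = 1 := Units.ext (by rw [hc, hc1, one_smul]; rfl)
    rw [hzt, hz1, one_mul]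
    exact ht

/-- A field line in a general linear group over a field `F` of characteristic zero is
isomorphic to `F`. -/
theorem IsFieldLine.nonempty_ringEquiv [CharZero F] (hn : 0 < n) {X P Q : GL (Fin n) F}
    (h : IsFieldLine X P Q) :
    letI := h.field
    Nonempty (F ≃+* lineSet X) := by
  obtain ⟨N, hN, hN0, hX, hT⟩ := h.exists_sqZero hn
  letI := h.field
  let u : F → lineSet X := fun b => ⟨sqZeroUnipotent hN b, (hT _).2 ⟨b, rfl⟩⟩
  have hu : Function.Bijective u := by
    refine ⟨fun a b hab => sqZeroUnipotent_injective hN hN0 (congrArg Subtype.val hab), ?_⟩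
    rintro ⟨t, ht⟩
    obtain ⟨b, rfl⟩ := (hT t).1 ht
    exact ⟨b, rfl⟩
  have hadd : ∀ a b, u (a + b) = u a + u b :=
    fun a b => Subtype.ext (sqZeroUnipotent_mul hN a b).symm
  have hone : u 1 = 1 := Subtype.ext hX.symm
  have hmul : ∀ a b, u (a * b) = u a * u b := by
    intro a b
    -- `f a` is the coordinate of the line product with `b` fixed; the aim is `f a = a * b`. The
    -- conjugators `P` and `Q` are arbitrary, so no commutator formula for elementary matrices is
    -- available.
    choose f hf using fun a => hu.2 (u a * u b)
    have hf1 : f 1 = b := hu.1 (by rw [hf, hone, one_mul])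
    have hf2 : f (1 + 1) = f 1 + f 1 := hu.1 (by rw [hf, hadd, hadd, add_mul, hf])
    obtain ⟨C₁, C₂, hC⟩ : ∃ C₁ C₂ : Matrix (Fin n) (Fin n) F,
        ∀ a, f a • N = a • C₁ + (a * a) • C₂ := by
      set Y := Q * sqZeroUnipotent hN b * Q⁻¹ with hY
      set K := P.val * N * P⁻¹.val with hK
      -- The coefficients of `a` and `a ^ 2` in the expansion of `(1 + a K) Y (1 - a K) Y⁻¹`.
      refine ⟨K - Y.val * K * Y⁻¹.val, -(K * Y.val * K * Y⁻¹.val), fun a => ?_⟩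
      have h₁ : sqZeroUnipotent hN (f a) = lineMul P Q (sqZeroUnipotent hN a)
          (sqZeroUnipotent hN b) := congrArg Subtype.val (hf a)
      have h₂ := congrArg Units.val h₁
      rw [lineMul, ← hY] at h₂
      have h₃ : (P * sqZeroUnipotent hN a * P⁻¹).val = 1 + a • K := by
        change P.val * (1 + a • N) * P⁻¹.val = _
        rw [mul_add, add_mul, mul_one, Units.mul_inv, mul_smul_comm, smul_mul_assoc]
      have h₄ : (P * sqZeroUnipotent hN a * P⁻¹)⁻¹.val = 1 - a • K := by
        rw [_root_.mul_inv_rev, _root_.mul_inv_rev, inv_inv, ← mul_assoc]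
        change P.val * (1 - a • N) * P⁻¹.val = _
        rw [mul_sub, sub_mul, mul_one, Units.mul_inv, mul_smul_comm, smul_mul_assoc]
      rw [Units.val_mul, Units.val_mul, Units.val_mul, h₃, h₄] at h₂
      have h₅ : (1 : Matrix (Fin n) (Fin n) F) + f a • N =
          (1 + a • K) * Y.val * (1 - a • K) * Y⁻¹.val := h₂
      simp only [add_mul, mul_sub, sub_mul, one_mul, mul_one, smul_mul_assoc, mul_smul_comm,
        Units.mul_inv, mul_assoc] at h₅
      rw [← add_right_inj (1 : Matrix (Fin n) (Fin n) F), h₅]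
      simp only [mul_assoc]
      module
    -- Distributivity gives `f 2 = 2 f 1`, which leaves `2 C₂ = 0`; then `f` is linear with `f 1 =
    -- b`.
    have hC₂ : C₂ = 0 := by
      have e₁ := hC 1
      have e₂ := hC (1 + 1)
      rw [hf2, add_smul, e₁] at e₂
      have e₃ : (2 : F) • C₂ = 0 := by
        have : (2 : F) • C₂ = ((1 + 1 : F) • C₁ + ((1 + 1 : F) * (1 + 1)) • C₂) -
            ((1 : F) • C₁ + ((1 : F) * 1) • C₂ + ((1 : F) • C₁ + ((1 : F) * 1) • C₂)) := by
          module
        rw [this, ← e₂, sub_self]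
      exact (smul_eq_zero.1 e₃).resolve_left two_ne_zero
    have hfa : f a = a * b := by
      have e₁ := hC 1
      have e₂ := hC a
      rw [hC₂, smul_zero, add_zero] at e₁ e₂
      rw [one_smul, hf1] at e₁
      rw [← e₁, smul_smul, ← sub_eq_zero, ← sub_smul] at e₂
      exact sub_eq_zero.1 ((smul_eq_zero.1 e₂).resolve_right hN0)
    rw [← hf a, hfa]
  exact ⟨{ Equiv.ofBijective u hu with map_mul' := hmul, map_add' := hadd }⟩

end GLLine

/-! ### Bounded generation -/

section Words

open Matrix

variable {F : Type*} [Field F] {n : ℕ}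

theorem transvection_mul_apply_eq (i j : Fin n) (a : F) (B : Matrix (Fin n) (Fin n) F)
    (p q : Fin n) :
    (transvection i j a * B) p q = B p q + if p = i then a * B j q else 0 := by
  split_ifs with h
  · subst h; rw [transvection_mul_apply_same]
  · rw [transvection_mul_apply_of_ne _ _ _ _ h, add_zero]

/-- For each `p ≠ c`, add `-B p c` times row `c` to row `p`. When the pivot `B c c` is `1`, this
clears the rest of column `c`. -/
theorem exists_transvections_clear_col (B : Matrix (Fin n) (Fin n) F) (c : Fin n) :
    ∃ l : List (TransvectionStruct (Fin n) F), l.length ≤ n ∧ ∀ p q,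
      ((l.map TransvectionStruct.toMatrix).prod * B) p q =
        B p q - if p = c then 0 else B p c * B c q := by
  have key : ∀ s : Finset (Fin n), c ∉ s → ∃ l : List (TransvectionStruct (Fin n) F),
      l.length = s.card ∧ ∀ p q, ((l.map TransvectionStruct.toMatrix).prod * B) p q =
        B p q - if p ∈ s then B p c * B c q else 0 := by
    intro s
    induction s using Finset.induction_on with
    | empty => intro _; exact ⟨[], rfl, by simp⟩
    | insert i s hi ih =>
      intro hc
      rw [Finset.mem_insert, not_or] at hc
      obtain ⟨l, hl, hl'⟩ := ih hc.2
      refine ⟨⟨i, c, Ne.symm hc.1, -B i c⟩ :: l, by simp [hl, hi], fun p q => ?_⟩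
      rw [List.map_cons, List.prod_cons, mul_assoc, TransvectionStruct.toMatrix_mk,
        transvection_mul_apply_eq, hl', hl']
      by_cases hpi : p = i
      · subst hpi; simp [hi, hc.2]; ring
      · simp [hpi]
  obtain ⟨l, hl, hl'⟩ := key (Finset.univ.erase c) (by simp)
  refine ⟨l, ?_, fun p q => ?_⟩
  · rw [hl, Finset.card_erase_of_mem (Finset.mem_univ c), Finset.card_univ, Fintype.card_fin]
    exact Nat.sub_le _ _
  · rw [hl']
    by_cases hp : p = c <;> simp [hp]

/-- The first `m` columns of `B` are those of the identity matrix. -/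
def FirstColumnsStandard (m : ℕ) (B : Matrix (Fin n) (Fin n) F) : Prop :=
  ∀ q : Fin n, (q : ℕ) < m → ∀ p, B p q = if p = q then 1 else 0

theorem FirstColumnsStandard.transvection_mul {m : ℕ} {B : Matrix (Fin n) (Fin n) F}
    (h : FirstColumnsStandard m B) (i j : Fin n) (hj : m ≤ j) (a : F) :
    FirstColumnsStandard m (transvection i j a * B) := by
  intro q hq p
  have hjq : j ≠ q := fun h' => by subst h'; omega
  rw [transvection_mul_apply_eq, h q hq, h q hq, if_neg hjq]
  simp

/-- Otherwise column `c` would be a combination of the preceding standard columns, and the vector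
below would lie in the kernel. -/
theorem FirstColumnsStandard.exists_ne_zero {B : Matrix (Fin n) (Fin n) F} {c : Fin n}
    (h : FirstColumnsStandard c B) (hB : B.det ≠ 0) : ∃ i, c ≤ i ∧ B i c ≠ 0 := by
  by_contra! hc
  refine hB (exists_mulVec_eq_zero_iff.1
    ⟨fun j => if j = c then 1 else if j < c then -B j c else 0, fun h0 => ?_, ?_⟩)
  · have := congrFun h0 c
    simp at this
  · funext i
    have hterm : ∀ j, B i j * (if j = c then 1 else if j < c then -B j c else 0) =
        (if j = c then B i c else 0) + if j = i then (if i < c then -B i c else 0) else 0 := by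
      intro j
      by_cases hj : j = c
      · subst hj
        by_cases hji : j = i
        · subst hji; simp
        · simp [hji]
      · by_cases hjc : j < c
        · rw [h j hjc]
          by_cases hji : j = i
          · subst hji; simp [hj, hjc]
          · simp [hj, hji, Ne.symm hji]
        · by_cases hji : j = i
          · subst hji; simp [hj, hjc]
          · simp [hj, hjc, hji]
    simp only [mulVec, dotProduct, hterm, Finset.sum_add_distrib, Finset.sum_ite_eq',
      Finset.mem_univ, if_true, Pi.zero_apply]
    split_ifs with hic
    · ring
    · rw [hc i (not_lt.1 hic), add_zero]

/-- Gaussian elimination with at most `n + 2` transvections per column: one to get a nonzero entry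
below the pivot, one to make the pivot `1`, and at most `n` to clear the column. The bound `m + 1 ≤
n` ensures that a row below the pivot exists. -/
theorem exists_transvections_firstColumnsStandard (A : Matrix (Fin n) (Fin n) F)
    (hA : A.det = 1) (m : ℕ) (hm : m + 1 ≤ n) :
    ∃ l : List (TransvectionStruct (Fin n) F), l.length ≤ m * (n + 2) ∧
      FirstColumnsStandard m ((l.map TransvectionStruct.toMatrix).prod * A) := by
  induction m with
  | zero => exact ⟨[], by simp, fun q hq => absurd hq (Nat.not_lt_zero _)⟩
  | succ m ih =>
    obtain ⟨l, hl, hB⟩ := ih (by omega)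
    set B := (l.map TransvectionStruct.toMatrix).prod * A with hBdef
    have hdet : B.det ≠ 0 := by
      rw [hBdef, det_mul, TransvectionStruct.det_toMatrix_prod, hA]; simp
    let c : Fin n := ⟨m, by omega⟩
    let d : Fin n := ⟨m + 1, by omega⟩
    have hdc : d ≠ c := fun h => by simp [c, d] at h
    obtain ⟨l₁, hl₁, hB₁, i, hic, hi⟩ : ∃ l₁ : List (TransvectionStruct (Fin n) F),
        l₁.length ≤ 1 ∧ FirstColumnsStandard m ((l₁.map TransvectionStruct.toMatrix).prod * B) ∧
        ∃ i, c ≠ i ∧ m ≤ (i : ℕ) ∧ ((l₁.map TransvectionStruct.toMatrix).prod * B) i c ≠ 0 := by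
      by_cases hex : ∃ i, c ≠ i ∧ m ≤ (i : ℕ) ∧ B i c ≠ 0
      · exact ⟨[], by simp, by simpa using hB, by simpa using hex⟩
      -- Here the pivot is the only nonzero entry from row `m` on; adding row `c` to the next row
      -- copies it below.
      · refine ⟨[⟨d, c, hdc, 1⟩], by simp, ?_, d, hdc.symm, by simp [d], ?_⟩
        · simpa using hB.transvection_mul d c (le_refl m) 1
        · obtain ⟨i, hi, hi'⟩ := FirstColumnsStandard.exists_ne_zero (c := c) hB hdet
          have hic : i = c := by
            by_contra hne
            exact hex ⟨i, Ne.symm hne, hi, hi'⟩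
          have hd0 : B d c = 0 := by
            by_contra hne
            exact hex ⟨d, hdc.symm, by simp [d], hne⟩
          simp only [List.map_cons, List.map_nil, List.prod_singleton,
            TransvectionStruct.toMatrix_mk, transvection_mul_apply_eq, hd0]
          simpa [hic] using hi'
    obtain ⟨him, hi⟩ := hi
    set B₁ := (l₁.map TransvectionStruct.toMatrix).prod * B with hB₁def
    set B₂ := transvection c i ((1 - B₁ c c) / B₁ i c) * B₁ with hB₂def
    have hB₂ : FirstColumnsStandard m B₂ := hB₁.transvection_mul c i him _
    have hcc : B₂ c c = 1 := by
      rw [hB₂def, transvection_mul_apply_eq, if_pos rfl, div_mul_cancel₀ _ hi]; ring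
    obtain ⟨l₂, hl₂, hl₂'⟩ := exists_transvections_clear_col B₂ c
    refine ⟨l₂ ++ (⟨c, i, hic, (1 - B₁ c c) / B₁ i c⟩ :: (l₁ ++ l)), ?_, ?_⟩
    · simp only [List.length_append, List.length_cons]
      nlinarith
    · have : ((l₂ ++ (⟨c, i, hic, (1 - B₁ c c) / B₁ i c⟩ :: (l₁ ++ l))).map
          TransvectionStruct.toMatrix).prod * A =
          (l₂.map TransvectionStruct.toMatrix).prod * B₂ := by
        simp only [hB₂def, hB₁def, hBdef, List.map_append, List.map_cons, List.prod_append,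
          List.prod_cons, mul_assoc, TransvectionStruct.toMatrix_mk]
      rw [this]
      intro q hq p
      rw [hl₂']
      rcases Nat.lt_succ_iff_lt_or_eq.1 hq with hq | hq
      · have hcq : c ≠ q := fun h' => by subst h'; simp [c] at hq
        rw [hB₂ q hq, hB₂ q hq, if_neg hcq]
        simp
      · have hqc : q = c := Fin.ext hq
        rw [hqc, hcc, mul_one]
        by_cases hp : p = c
        · rw [hp, if_pos rfl, if_pos rfl, hcc, sub_zero]
        · rw [if_neg hp, if_neg hp, sub_self]

theorem exists_transvections_eq (hn : 0 < n) (A : Matrix (Fin n) (Fin n) F) (hA : A.det = 1) :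
    ∃ l : List (TransvectionStruct (Fin n) F), l.length ≤ n * (n + 2) ∧
      A = (l.map TransvectionStruct.toMatrix).prod := by
  have hA' : A⁻¹.det = 1 := by rw [det_nonsing_inv, hA, Ring.inverse_one]
  obtain ⟨m, rfl⟩ : ∃ m, n = m + 1 := ⟨n - 1, by omega⟩
  -- Reducing `A⁻¹` to the identity writes `A` itself as the product, with no need to invert the
  -- transvections.
  obtain ⟨l, hl, hB⟩ := exists_transvections_firstColumnsStandard A⁻¹ hA' m le_rfl
  set B := (l.map TransvectionStruct.toMatrix).prod * A⁻¹ with hBdef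
  have hdet : B.det = 1 := by
    rw [hBdef, det_mul, TransvectionStruct.det_toMatrix_prod, hA', one_mul]
  have hlast : B (Fin.last m) (Fin.last m) = 1 := by
    rw [det_of_upperTriangular] at hdet
    · rw [Fin.prod_univ_castSucc, Finset.prod_eq_one, one_mul] at hdet
      · exact hdet
      · intro i _
        rw [hB i.castSucc (by simp), if_pos rfl]
    · intro i j hij
      have hij' : j < i := hij
      rw [hB j (lt_of_lt_of_le (Fin.lt_def.1 hij') (Nat.lt_succ_iff.1 i.2)), if_neg hij'.ne']
  obtain ⟨l', hl', h'⟩ := exists_transvections_clear_col B (Fin.last m)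
  refine ⟨l' ++ l, ?_, ?_⟩
  · simp only [List.length_append]
    nlinarith
  · have h1 : (l'.map TransvectionStruct.toMatrix).prod * B = 1 := by
      ext p q
      rw [h', one_apply]
      by_cases hq : q = Fin.last m
      · subst hq
        by_cases hp : p = Fin.last m
        · subst hp; simp [hlast]
        · simp [hp, hlast]
      · have hq' : (q : ℕ) < m := Fin.val_lt_last hq
        rw [hB q hq', hB q hq', if_neg (Ne.symm hq)]
        simp
    have hu : IsUnit A.det := by rw [hA]; exact isUnit_one
    rw [List.map_append, List.prod_append]
    have h2 := congrArg (· * A) h1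
    simp only [hBdef, mul_assoc, nonsing_inv_mul A hu, mul_one, one_mul] at h2
    exact h2.symm

/-- The generators of `SL_n(F) · ⟨d_1⟩`: `none` stands for `d_1` and `some (i, j)` for the
family of elementary matrices in position `(i, j)`. -/
abbrev Letter (n : ℕ) : Type := Option {q : Fin n × Fin n // q.1 ≠ q.2}

def letterMatrix (a : F) : Letter n → Matrix (Fin n) (Fin n) F
  | none => diagonal fun i => if (i : ℕ) = 0 then -1 else 1
  | some q => transvection q.1.1 q.1.2 a

def wordMatrix {N : ℕ} (π : Fin N → Letter n) (x : Fin N → F) : Matrix (Fin n) (Fin n) F :=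
  ((List.finRange N).map fun k => letterMatrix (x k) (π k)).prod

theorem letterMatrix_none_mul_self :
    letterMatrix (0 : F) (none : Letter n) * letterMatrix (0 : F) (none : Letter n) = 1 := by
  rw [letterMatrix, diagonal_mul_diagonal, ← diagonal_one]
  congr 1
  funext i
  split_ifs <;> simp

theorem det_letterMatrix_none (hn : 0 < n) (a : F) :
    (letterMatrix a (none : Letter n)).det = -1 := by
  rw [letterMatrix, det_diagonal, Finset.prod_eq_single (⟨0, hn⟩ : Fin n)]
  · simp
  · intro i _ hi
    rw [if_neg fun h => hi (Fin.ext h)]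
  · simp

theorem det_wordMatrix (hn : 0 < n) {N : ℕ} (π : Fin N → Letter n) (x : Fin N → F) :
    (wordMatrix π x).det = 1 ∨ (wordMatrix π x).det = -1 := by
  rw [wordMatrix]
  induction List.finRange N with
  | nil => simp
  | cons k l ih =>
    rw [List.map_cons, List.prod_cons, det_mul]
    have hk : (letterMatrix (x k) (π k)).det = 1 ∨ (letterMatrix (x k) (π k)).det = -1 := by
      rcases π k with _ | q
      · exact Or.inr (det_letterMatrix_none hn _)
      · exact Or.inl (det_transvection_of_ne _ _ q.2 _)
    rcases hk with hk | hk <;> rcases ih with ih | ih <;> simp [hk, ih]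

/-- A length such that all matrices of determinant `1` or `-1` are words of this length. -/
def wordLength (n : ℕ) : ℕ := n * (n + 2) + 1

/-- One letter `d_1` corrects the determinant if necessary. Trivial transvections pad every word to
the same length, so that a quantifier over words is a finite choice of letters and a tuple of field
elements. -/
theorem exists_wordMatrix_eq (hn : 2 ≤ n) (A : Matrix (Fin n) (Fin n) F)
    (hA : A.det = 1 ∨ A.det = -1) :
    ∃ (π : Fin (wordLength n) → Letter n) (x : Fin (wordLength n) → F), A = wordMatrix π x := by
  suffices h : ∃ l : List (Letter n × F), l.length = wordLength n ∧
      A = (l.map fun q => letterMatrix q.2 q.1).prod by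
    obtain ⟨l, hl, hA⟩ := h
    rw [← hl]
    refine ⟨fun k => (l.get k).1, fun k => (l.get k).2, ?_⟩
    rw [wordMatrix, hA]
    congr 1
    conv_lhs => rw [← List.map_get_finRange l, List.map_map]
    rfl
  obtain ⟨l₁, hl₁, A₁, hA₁, hAA⟩ : ∃ l₁ : List (Letter n × F), l₁.length ≤ 1 ∧
      ∃ A₁ : Matrix (Fin n) (Fin n) F, A₁.det = 1 ∧
        A = (l₁.map fun q => letterMatrix q.2 q.1).prod * A₁ := by
    rcases hA with hA | hA
    · exact ⟨[], by simp, A, hA, by simp⟩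
    · refine ⟨[(none, 0)], by simp, letterMatrix (0 : F) (none : Letter n) * A, ?_, ?_⟩
      · rw [det_mul, det_letterMatrix_none (by omega), hA]; simp
      · rw [List.map_singleton, List.prod_singleton, ← mul_assoc, letterMatrix_none_mul_self,
          one_mul]
  obtain ⟨l₂, hl₂, hA₂⟩ := exists_transvections_eq (by omega) A₁ hA₁
  let q₀ : Letter n := some ⟨(⟨0, by omega⟩, ⟨1, by omega⟩), by simp⟩
  have hq₀ : letterMatrix (0 : F) q₀ = 1 := transvection_zero _ _
  refine ⟨l₁ ++ (l₂.map fun t => ((some ⟨(t.i, t.j), t.hij⟩ : Letter n), t.c)) ++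
    List.replicate (wordLength n - l₁.length - l₂.length) (q₀, 0), ?_, ?_⟩
  · have : n * (n + 2) + 1 = wordLength n := rfl
    simp only [List.length_append, List.length_map, List.length_replicate]
    omega
  · rw [List.map_append, List.map_append, List.prod_append, List.prod_append, List.map_replicate,
      List.prod_replicate, hq₀, one_pow, mul_one, hAA, hA₂, List.map_map]
    rfl

theorem mem_slDOne_iff (hn : 0 < n) (A : GL (Fin n) F) :
    A ∈ slDOne n F ↔ A.val.det = 1 ∨ A.val.det = -1 := by
  have hd : (dOne n (-1 : Fˣ)).val = letterMatrix (0 : F) (none : Letter n) := by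
    simp [dOne, letterMatrix]
  constructor
  · intro h
    have h1 : GeneralLinearGroup.det (dOne n (-1 : Fˣ)) = -1 := by
      refine Units.ext ?_
      rw [GeneralLinearGroup.val_det_apply, hd, det_letterMatrix_none hn]
      rfl
    have hle : slDOne n F ≤ (Subgroup.zpowers (-1 : Fˣ)).comap GeneralLinearGroup.det := by
      refine sup_le ?_ (Subgroup.zpowers_le.2 ?_)
      · rintro _ ⟨B, rfl⟩
        exact Subgroup.mem_comap.2 ⟨0, (zpow_zero _).trans (Units.ext B.2.symm)⟩
      · exact Subgroup.mem_comap.2 (by rw [h1]; exact Subgroup.mem_zpowers _)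
    obtain ⟨k, hk⟩ := Subgroup.mem_zpowers_iff.1 (Subgroup.mem_comap.1 (hle h))
    rw [← GeneralLinearGroup.val_det_apply, ← hk]
    rcases Int.even_or_odd k with hk | hk
    · left; rw [hk.neg_one_zpow]; rfl
    · right; rw [hk.neg_one_zpow]; rfl
  · rintro (h | h)
    · exact Subgroup.mem_sup_left ⟨⟨A.val, h⟩, Units.ext rfl⟩
    · have h1 : (letterMatrix (0 : F) (none : Letter n) * A.val).det = 1 := by
        rw [det_mul, det_letterMatrix_none hn, h]; simp
      have h2 : A = dOne n (-1 : Fˣ) * SpecialLinearGroup.toGL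
          ⟨letterMatrix (0 : F) (none : Letter n) * A.val, h1⟩ := by
        refine Units.ext ?_
        rw [Units.val_mul, hd]
        change A.val = _ * (_ * A.val)
        rw [← mul_assoc, letterMatrix_none_mul_self, one_mul]
      rw [h2]
      exact mul_mem (Subgroup.mem_sup_right (Subgroup.mem_zpowers _))
        (Subgroup.mem_sup_left ⟨_, rfl⟩)

end Words

/-! ### Frames -/

section Frames

variable {n : ℕ}

/-- A frame in a group consists of an element generating a field line (index `none`), an element
in the role of `d_1` (index `some none`), and elements conjugating the field line to the root
subgroups in the other positions. -/
abbrev FrameIndex (n : ℕ) : Type := Option (Letter n)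

def indexPair (hn : 3 ≤ n) (i j : Fin 3) (h : i ≠ j) : {q : Fin n × Fin n // q.1 ≠ q.2} :=
  ⟨(Fin.castLE hn i, Fin.castLE hn j), fun h' => h (Fin.castLE_injective hn h')⟩

/-- The field line plays the root subgroup in position `(0, 1)`. The conjugators to `(0, 2)` and
`(2, 1)` serve as the two conjugators in `lineMul`, since the commutator of those root subgroups
lands in `(0, 1)`. -/
def lineLeft (hn : 3 ≤ n) : FrameIndex n := some (some (indexPair hn 0 2 (by decide)))

def lineRight (hn : 3 ≤ n) : FrameIndex n := some (some (indexPair hn 2 1 (by decide)))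

section

variable {M : Type*} [Group M]

def IsFrame (hn : 3 ≤ n) (v : FrameIndex n → M) : Prop :=
  IsFieldLine (v none) (v (lineLeft hn)) (v (lineRight hn))

def letterElem (v : FrameIndex n → M) (x : M) : Letter n → M
  | none => v (some none)
  | some q => v (some (some q)) * x * (v (some (some q)))⁻¹

def wordElem {N : ℕ} (v : FrameIndex n → M) (π : Fin N → Letter n) (x : Fin N → M) : M :=
  ((List.finRange N).map fun k => letterElem v (x k) (π k)).prod

/-- The conjunction exposes the logical shape on which the syntactic proof of definability recurses.
-/
theorem isFieldLine_iff (X P Q : M) : IsFieldLine X P Q ↔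
    (∀ x, x ∈ lineSet X → ∀ y, y ∈ lineSet X → x * y ∈ lineSet X) ∧
    (∀ x, x ∈ lineSet X → x⁻¹ ∈ lineSet X) ∧
    (∀ x, x ∈ lineSet X → ∀ y, y ∈ lineSet X → x * y = y * x) ∧
    (¬ X * X = 1) ∧
    (∀ x, x ∈ lineSet X → ∀ y, y ∈ lineSet X → lineMul P Q x y ∈ lineSet X) ∧
    (∀ x, x ∈ lineSet X → ∀ y, y ∈ lineSet X → lineMul P Q x y = lineMul P Q y x) ∧
    (∀ x, x ∈ lineSet X → ∀ y, y ∈ lineSet X → ∀ z, z ∈ lineSet X →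
      lineMul P Q (lineMul P Q x y) z = lineMul P Q x (lineMul P Q y z)) ∧
    (∀ x, x ∈ lineSet X → ∀ y, y ∈ lineSet X → ∀ z, z ∈ lineSet X →
      lineMul P Q x (y * z) = lineMul P Q x y * lineMul P Q x z) ∧
    (∀ x, x ∈ lineSet X → lineMul P Q X x = x) ∧
    (∀ x, x ∈ lineSet X → ¬ x = 1 → ∃ y, y ∈ lineSet X ∧ lineMul P Q x y = X) ∧
    (∀ y, InBicentralizer X y →
      ∃ z, (∀ g, g * z = z * g) ∧ ∃ t, t ∈ lineSet X ∧ y = z * t) :=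
  ⟨fun ⟨a, b, c, d, e, f, g, h, i, j, k⟩ => ⟨a, b, c, d, e, f, g, h, i, j, k⟩,
    fun ⟨a, b, c, d, e, f, g, h, i, j, k⟩ => ⟨a, b, c, d, e, f, g, h, i, j, k⟩⟩

end

namespace GroupDefinable

variable {α : Type}

theorem inBicentralizer {f g : ∀ (M : Type u) [Group M], (α → M) → M}
    (hf : GroupTerm fun M _ (w : α ⊕ Unit → M) => f M fun a => w (Sum.inl a))
    (hg : GroupTerm fun M _ (w : α ⊕ Unit → M) => g M fun a => w (Sum.inl a)) :
    GroupDefinable fun M _ v => InBicentralizer (f M v) (g M v) := by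
  unfold InBicentralizer
  have h := GroupTerm.var.{u} (Sum.inr () : α ⊕ Unit)
  exact forall_elem (imp (eq (h.mul hf) (hf.mul h)) (eq (hg.mul h) (h.mul hg)))

theorem lineMul_term {f g h k : ∀ (M : Type u) [Group M], (α → M) → M} (hf : GroupTerm f)
    (hg : GroupTerm g) (hh : GroupTerm h) (hk : GroupTerm k) :
    GroupTerm fun M _ v => lineMul (f M v) (g M v) (h M v) (k M v) := by
  have h₁ := (hf.mul hh).mul hf.inv
  have h₂ := (hg.mul hk).mul hg.inv
  exact ((h₁.mul h₂).mul h₁.inv).mul h₂.inv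

theorem mem_lineSet {f : ∀ (M : Type u) [Group M], (α → M) → M} (b : α) (hf : GroupTerm f) :
    GroupDefinable fun M _ v => f M v ∈ lineSet (v b) := by
  have hw : GroupTerm fun M _ (w : α ⊕ Unit → M) => f M fun a => w (Sum.inl a) := by
    obtain ⟨t, ht⟩ := hf
    exact ⟨t.relabel Sum.inl, fun M _ w => by rw [Language.Term.realize_relabel, ht]; rfl⟩
  have h := GroupTerm.var.{u} (Sum.inr () : α ⊕ Unit)
  have hb := GroupTerm.var.{u} (Sum.inl b : α ⊕ Unit)
  exact and (inBicentralizer hb hw)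
    (or (eq hf GroupTerm.one) (exists_elem (eq hw ((h.mul hb).mul h.inv))))

theorem isFieldLine (a b c : α) :
    GroupDefinable.{u} fun _ _ v => IsFieldLine (v a) (v b) (v c) := by
  simp only [isFieldLine_iff]
  repeat' first
    | with_reducible apply GroupDefinable.and
    | with_reducible apply GroupDefinable.not
    | with_reducible apply GroupDefinable.forall_elem
    | with_reducible apply GroupDefinable.exists_elem
    | with_reducible apply GroupDefinable.mem_lineSet
    | with_reducible apply GroupDefinable.inBicentralizer
    | with_reducible apply GroupDefinable.eq
    | with_reducible apply GroupDefinable.lineMul_term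
    | with_reducible apply GroupTerm.var
    | with_reducible apply GroupTerm.one
    | with_reducible apply GroupTerm.mul
    | with_reducible apply GroupTerm.inv
    | with_reducible apply GroupDefinable.imp

end GroupDefinable

theorem GroupTerm.wordElem {α : Type} {N : ℕ} (r : FrameIndex n → α) (π : Fin N → Letter n)
    (s : Fin N → α) :
    GroupTerm.{u} fun _ _ v => wordElem (fun a => v (r a)) π fun k => v (s k) := by
  refine GroupTerm.listProd _ fun k => ?_
  rcases π k with _ | q
  · exact GroupTerm.var _
  · exact ((GroupTerm.var _).mul (GroupTerm.var _)).mul (GroupTerm.var _).inv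

/-- The field lines attached to frames are uniformly interpreted in groups. -/
theorem exists_lineInterpretation (hn : 3 ≤ n) :
    ∃ I : TermInterpretation groupLanguage Language.ring (FrameIndex n) Unit,
      ∀ (M : Type u) [Group M] (v : FrameIndex n → M) (h : IsFrame hn v),
        letI := IsFieldLine.field h
        letI := Ring.compatibleRingOfRing (lineSet (v none))
        I.Realizes v fun (x : lineSet (v none)) (_ : Unit) => x.1 := by
  obtain ⟨D, hD⟩ := GroupDefinable.mem_lineSet.{u} (α := Unit ⊕ FrameIndex n) (Sum.inr none)
    (GroupTerm.var (Sum.inl ()))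
  obtain ⟨ta, hta⟩ := (GroupTerm.var.{u} (Sum.inl (0, ()) : (Fin 2 × Unit) ⊕ FrameIndex n)).mul
    (GroupTerm.var (Sum.inl (1, ())))
  obtain ⟨tm, htm⟩ := GroupDefinable.lineMul_term.{u} (α := (Fin 2 × Unit) ⊕ FrameIndex n)
    (GroupTerm.var (Sum.inr (lineLeft hn))) (GroupTerm.var (Sum.inr (lineRight hn)))
    (GroupTerm.var (Sum.inl (0, ()))) (GroupTerm.var (Sum.inl (1, ())))
  obtain ⟨tn, htn⟩ := (GroupTerm.var.{u} (Sum.inl (0, ()) : (Fin 1 × Unit) ⊕ FrameIndex n)).inv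
  obtain ⟨tz, htz⟩ := GroupTerm.one.{u} (α := (Fin 0 × Unit) ⊕ FrameIndex n)
  obtain ⟨te, hte⟩ := GroupTerm.var.{u} (Sum.inr none : (Fin 0 × Unit) ⊕ FrameIndex n)
  refine ⟨⟨D, fun {k} f _ => match k, f with
    | _, ringFunc.add => ta
    | _, ringFunc.mul => tm
    | _, ringFunc.neg => tn
    | _, ringFunc.zero => tz
    | _, ringFunc.one => te⟩, fun M _ v h => ?_⟩
  letI := IsFieldLine.field h
  letI := Ring.compatibleRingOfRing (lineSet (v none))
  refine ⟨fun x y hxy => Subtype.ext (congrFun hxy ()), fun y => ?_, fun {k} f x i => ?_⟩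
  · refine (hD M _).trans ⟨fun hy => ⟨⟨y (), hy⟩, rfl⟩, ?_⟩
    rintro ⟨a, rfl⟩
    exact a.2
  · cases f
    · exact (hta M (Sum.elim (fun q => (x q.1).1) v)).symm
    · exact (htm M (Sum.elim (fun q => (x q.1).1) v)).symm
    · exact (htn M (Sum.elim (fun q => (x q.1).1) v)).symm
    · exact (htz M (Sum.elim (fun q => (x q.1).1) v)).symm
    · exact (hte M (Sum.elim (fun q => (x q.1).1) v)).symm

theorem ringTerm_wordMatrix {α : Type} {N : ℕ} (π : Fin N → Letter n) (s : Fin N → α)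
    (i j : Fin n) :
    RingTerm.{u} fun _ _ v => wordMatrix π (fun k => v (s k)) i j := by
  unfold wordMatrix
  refine RingTerm.matrix_listProd _ (fun k i j => ?_) i j
  rcases π k with _ | q
  · simp only [letterMatrix, Matrix.diagonal_apply]
    exact RingTerm.ite _ (RingTerm.ite _ RingTerm.one.neg RingTerm.one) RingTerm.zero
  · simp only [letterMatrix, Matrix.transvection, Matrix.add_apply, Matrix.one_apply,
      Matrix.single_apply]
    exact (RingTerm.ite _ RingTerm.one RingTerm.zero).add
      (RingTerm.ite _ (RingTerm.var _) RingTerm.zero)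

/-- The variables for the coordinates of three words. -/
abbrev WordVars (N : ℕ) : Type := Fin N ⊕ Fin N ⊕ Fin N

/-- The multiplication of words in matrices over the field attached to a frame is expressed by
formulas in the language of groups. -/
theorem exists_wordFormula (hn : 3 ≤ n) (N : ℕ) (π₁ π₂ π₃ : Fin N → Letter n) :
    ∃ φ : groupLanguage.Formula ((WordVars N × Unit) ⊕ FrameIndex n),
      ∀ (M : Type u) [Group M] (v : FrameIndex n → M) (h : IsFrame hn v)
        (x y z : Fin N → lineSet (v none)),
        letI := IsFieldLine.field h
        (φ.Realize (Sum.elim (fun q => Sum.elim (fun k => (x k).1)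
          (Sum.elim (fun k => (y k).1) fun k => (z k).1) q.1) v) ↔
          wordMatrix π₁ x * wordMatrix π₂ y = wordMatrix π₃ z) := by
  obtain ⟨I, hI⟩ := exists_lineInterpretation.{u} hn
  obtain ⟨ψ, hψ⟩ := RingTerm.exists_matrix_eq_formula.{u}
    (RingTerm.matrix_mul (ringTerm_wordMatrix π₁ (Sum.inl : Fin N → WordVars N))
      (ringTerm_wordMatrix π₂ fun k => (Sum.inr (Sum.inl k) : WordVars N)))
    (ringTerm_wordMatrix π₃ fun k => (Sum.inr (Sum.inr k) : WordVars N))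
  obtain ⟨φ, hφ⟩ := I.exists_formula.{u} ψ
  refine ⟨φ, fun M _ v h x y z => ?_⟩
  letI := IsFieldLine.field h
  letI := Ring.compatibleRingOfRing (lineSet (v none))
  have h₁ := hφ M (lineSet (v none)) v _ (hI M v h) (Sum.elim x (Sum.elim y z))
  refine Iff.trans (iff_of_eq ?_) (h₁.symm.trans (hψ _ _))
  congr 1
  funext q
  rcases q with ⟨q | q | q, _⟩ | q <;> rfl

end Frames

/-! ### Coordinatization of a group by a frame -/

section Coordinates

open Matrix

variable {n : ℕ}

/-- The words over the frame `v` multiply like the corresponding matrices over the field of the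
frame, and they form a complement of the group of squares of central elements. -/
structure CoordinatizingFrame (hn : 3 ≤ n) {M : Type*} [Group M] (v : FrameIndex n → M) :
    Prop where
  isFrame : IsFrame hn v
  mul_iff : ∀ (π₁ π₂ π₃ : Fin (wordLength n) → Letter n)
    (x y z : Fin (wordLength n) → lineSet (v none)),
    letI := isFrame.field
    ((wordElem v π₁ fun k => (x k).1) * (wordElem v π₂ fun k => (y k).1) =
      (wordElem v π₃ fun k => (z k).1) ↔
      wordMatrix π₁ x * wordMatrix π₂ y = wordMatrix π₃ z)
  exists_eq : ∀ g : M, ∃ (π : Fin (wordLength n) → Letter n)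
    (x : Fin (wordLength n) → lineSet (v none)) (z : M), (∀ h, h * z = z * h) ∧
    g = (wordElem v π fun k => (x k).1) * (z * z)
  eq_one : ∀ (π : Fin (wordLength n) → Letter n) (x : Fin (wordLength n) → lineSet (v none))
    (z : M), (∀ h, h * z = z * h) → (wordElem v π fun k => (x k).1) = z * z → z * z = 1

/-- Choose a word for each matrix and evaluate it in `M`. By `mul_iff` this is a homomorphism;
`exists_eq` and `eq_one` make its product with the inclusion of `centerSquares M` bijective. -/
theorem CoordinatizingFrame.nonempty_mulEquiv {hn : 3 ≤ n} {M : Type u} [Group M]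
    {v : FrameIndex n → M} (h : CoordinatizingFrame hn v) :
    letI := h.isFrame.field
    Nonempty (M ≃* slDOne n (lineSet (v none)) × centerSquares M) := by
  letI := h.isFrame.field
  have hn0 : 0 < n := by omega
  choose π x hπx using fun A : slDOne n (lineSet (v none)) =>
    exists_wordMatrix_eq (by omega) A.1.val ((mem_slDOne_iff hn0 A.1).1 A.2)
  let e : slDOne n (lineSet (v none)) →* M :=
    MonoidHom.mk' (fun A => wordElem v (π A) fun k => (x A k).1) fun A B => by
      refine ((h.mul_iff _ _ _ _ _ _).2 ?_).symm
      rw [← hπx, ← hπx, ← hπx]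
      rfl
  have hcent : ∀ b ∈ centerSquares M, ∀ g, b * g = g * b := by
    rintro _ ⟨z, hz, rfl⟩ g
    exact ((Subgroup.mem_center_iff.1 (pow_mem hz 2)) g).symm
  let f : slDOne n (lineSet (v none)) × centerSquares M →* M :=
    MonoidHom.mk' (fun q => e q.1 * q.2.1) fun q r => by
      change e (q.1 * r.1) * (q.2.1 * r.2.1) = e q.1 * q.2.1 * (e r.1 * r.2.1)
      rw [map_mul, mul_assoc, mul_assoc, ← mul_assoc q.2.1 (e r.1), hcent _ q.2.2 (e r.1), mul_assoc]
  have hf : Function.Bijective f := by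
    constructor
    · rw [injective_iff_map_eq_one]
      rintro ⟨A, b, hb⟩ hq
      have hq' : e A * b = 1 := hq
      have hAb : e A = b⁻¹ := eq_inv_of_mul_eq_one_left hq'
      obtain ⟨z, hz, hzb⟩ := (centerSquares M).inv_mem hb
      rw [← hzb, pow_two] at hAb
      have hz1 := h.eq_one _ _ z (Subgroup.mem_center_iff.1 hz) hAb
      have hb1 : b = 1 := by rw [← inv_eq_one, ← hzb, pow_two, hz1]
      -- Triviality is phrased as idempotence, an equation between words that `mul_iff` turns into
      -- one between matrices.
      have hA1 : e A * e A = e A := by rw [hAb, hz1, mul_one]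
      have hA2 := (h.mul_iff _ _ _ _ _ _).1 hA1
      rw [← hπx] at hA2
      have hA3 : A.1 * A.1 = A.1 := Units.ext hA2
      refine Prod.ext (Subtype.ext ?_) (Subtype.ext hb1)
      exact mul_eq_left.1 hA3
    · intro g
      obtain ⟨ρ, y, z, hz, hg⟩ := h.exists_eq g
      have hdet := det_wordMatrix hn0 ρ y
      have hu : IsUnit (wordMatrix ρ y) := by
        rw [isUnit_iff_isUnit_det]
        rcases hdet with hd | hd <;> simp [hd]
      let A : slDOne n (lineSet (v none)) :=
        ⟨hu.unit, (mem_slDOne_iff hn0 _).2 (by rw [IsUnit.unit_spec]; exact hdet)⟩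
      -- Multiplying by `e 1` brings `mul_iff` to bear: two words with the same matrix have the same
      -- value in `M`.
      have hA : e A * e 1 = wordElem v ρ fun k => (y k).1 := by
        refine (h.mul_iff _ _ _ _ _ _).2 ?_
        rw [← hπx, ← hπx]
        exact mul_one _
      rw [map_one, mul_one] at hA
      refine ⟨(A, ⟨z * z, z, Subgroup.mem_center_iff.2 hz, pow_two z⟩), ?_⟩
      change e A * (z * z) = g
      rw [hg, hA]
  exact ⟨(MulEquiv.ofBijective f hf).symm⟩

/-- Having a coordinatizing frame is a first-order property of a group. -/
theorem groupDefinable_coordinatizingFrame (hn : 3 ≤ n) :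
    GroupDefinable.{u} fun M _ (_ : Empty → M) =>
      ∃ v : FrameIndex n → M, CoordinatizingFrame hn v := by
  choose φ hφ using exists_wordFormula.{u} hn (wordLength n)
  -- Variables in the line become relativized group variables, and matrix identities become the
  -- formulas `φ`; what remains is visibly first-order.
  have key : ∀ (M : Type u) [Group M] (v : FrameIndex n → M), CoordinatizingFrame hn v ↔
      IsFrame hn v ∧
      (∀ π₁ π₂ π₃ : Fin (wordLength n) → Letter n, ∀ x : WordVars (wordLength n) → M,
        (∀ k, x k ∈ lineSet (v none)) →
        (wordElem v π₁ (fun k => x (Sum.inl k)) * wordElem v π₂ (fun k => x (Sum.inr (Sum.inl k))) =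
          wordElem v π₃ (fun k => x (Sum.inr (Sum.inr k))) ↔
          (φ π₁ π₂ π₃).Realize fun q => Sum.elim (fun q => x q.1) v q)) ∧
      (∀ g : M, ∃ π : Fin (wordLength n) → Letter n, ∃ x : Fin (wordLength n) → M,
        (∀ k, x k ∈ lineSet (v none)) ∧ ∃ z : M, (∀ h, h * z = z * h) ∧
          g = wordElem v π x * (z * z)) ∧
      (∀ π : Fin (wordLength n) → Letter n, ∀ x : Fin (wordLength n) → M,
        (∀ k, x k ∈ lineSet (v none)) → ∀ z : M, (∀ h, h * z = z * h) →
          wordElem v π x = z * z → z * z = 1) := by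
    intro M _ v
    have hφ' : ∀ (h : IsFrame hn v) (π₁ π₂ π₃) (x : WordVars (wordLength n) → M)
        (hx : ∀ k, x k ∈ lineSet (v none)),
        letI := IsFieldLine.field h
        ((φ π₁ π₂ π₃).Realize (fun q => Sum.elim (fun q => x q.1) v q) ↔
          wordMatrix π₁ (fun k => (⟨x (Sum.inl k), hx _⟩ : lineSet (v none))) *
          wordMatrix π₂ (fun k => (⟨x (Sum.inr (Sum.inl k)), hx _⟩ : lineSet (v none))) =
          wordMatrix π₃ (fun k => (⟨x (Sum.inr (Sum.inr k)), hx _⟩ : lineSet (v none)))) := by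
      intro h π₁ π₂ π₃ x hx
      refine Iff.trans (iff_of_eq ?_) (hφ π₁ π₂ π₃ M v h _ _ _)
      congr 1
      funext q
      rcases q with ⟨q | q | q, _⟩ | q <;> rfl
    constructor
    · intro h
      refine ⟨h.isFrame, fun π₁ π₂ π₃ x hx => ?_, fun g => ?_, fun π x hx z hz hxz => ?_⟩
      · rw [hφ' h.isFrame π₁ π₂ π₃ x hx]
        exact h.mul_iff π₁ π₂ π₃ (fun k => ⟨x (Sum.inl k), hx _⟩)
          (fun k => ⟨x (Sum.inr (Sum.inl k)), hx _⟩) (fun k => ⟨x (Sum.inr (Sum.inr k)), hx _⟩)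
      · obtain ⟨π, x, z, hz, hg⟩ := h.exists_eq g
        exact ⟨π, fun k => (x k).1, fun k => (x k).2, z, hz, hg⟩
      · exact h.eq_one π (fun k => ⟨x k, hx k⟩) z hz hxz
    · rintro ⟨h₁, h₂, h₃, h₄⟩
      refine ⟨h₁, fun π₁ π₂ π₃ x y z => ?_, fun g => ?_, fun π x z hz hxz => ?_⟩
      · let w : WordVars (wordLength n) → M := Sum.elim (fun k => (x k).1)
          (Sum.elim (fun k => (y k).1) fun k => (z k).1)
        have hw : ∀ k, w k ∈ lineSet (v none) := by
          rintro (k | k | k)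
          exacts [(x k).2, (y k).2, (z k).2]
        exact (h₂ π₁ π₂ π₃ w hw).trans (hφ' h₁ π₁ π₂ π₃ w hw)
      · obtain ⟨π, x, hx, z, hz, hg⟩ := h₃ g
        exact ⟨π, fun k => ⟨x k, hx k⟩, z, hz, hg⟩
      · exact h₄ π _ (fun k => (x k).2) z hz hxz
  simp only [key]
  refine GroupDefinable.exists_tuple (GroupDefinable.and ?_ (GroupDefinable.and ?_
    (GroupDefinable.and ?_ ?_)))
  · exact GroupDefinable.isFieldLine _ _ _
  · refine GroupDefinable.forall_index fun π₁ => GroupDefinable.forall_index fun π₂ =>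
      GroupDefinable.forall_index fun π₃ => GroupDefinable.forall_tuple
        (GroupDefinable.imp (GroupDefinable.forall_index fun k =>
          GroupDefinable.mem_lineSet _ (GroupTerm.var _)) (GroupDefinable.iff (GroupDefinable.eq
            (GroupTerm.mul (GroupTerm.wordElem _ _ _) (GroupTerm.wordElem _ _ _))
            (GroupTerm.wordElem _ _ _)) (GroupDefinable.realize _ ?_)))
    rintro (q | q)
    · exact GroupTerm.var _
    · exact GroupTerm.var _
  · exact GroupDefinable.forall_elem (GroupDefinable.exists_index fun π =>
      GroupDefinable.exists_tuple (GroupDefinable.and (GroupDefinable.forall_index fun k =>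
        GroupDefinable.mem_lineSet _ (GroupTerm.var _)) (GroupDefinable.exists_elem
          (GroupDefinable.and (GroupDefinable.forall_elem (GroupDefinable.eq
            (GroupTerm.mul (GroupTerm.var _) (GroupTerm.var _))
            (GroupTerm.mul (GroupTerm.var _) (GroupTerm.var _))))
            (GroupDefinable.eq (GroupTerm.var _) (GroupTerm.mul (GroupTerm.wordElem _ _ _)
              (GroupTerm.mul (GroupTerm.var _) (GroupTerm.var _))))))))
  · exact GroupDefinable.forall_index fun π => GroupDefinable.forall_tuple
      (GroupDefinable.imp (GroupDefinable.forall_index fun k =>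
        GroupDefinable.mem_lineSet _ (GroupTerm.var _)) (GroupDefinable.forall_elem
          (GroupDefinable.imp (GroupDefinable.forall_elem (GroupDefinable.eq
            (GroupTerm.mul (GroupTerm.var _) (GroupTerm.var _))
            (GroupTerm.mul (GroupTerm.var _) (GroupTerm.var _))))
            (GroupDefinable.imp (GroupDefinable.eq (GroupTerm.wordElem _ _ _)
              (GroupTerm.mul (GroupTerm.var _) (GroupTerm.var _)))
              (GroupDefinable.eq (GroupTerm.mul (GroupTerm.var _) (GroupTerm.var _))
                GroupTerm.one)))))

/-- If the fields of all frames in `G` are elementarily equivalent to `F`, then so are those of all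
frames in every group elementarily equivalent to `G`. -/
theorem fieldElemEquiv_of_frames (hn : 3 ≤ n) {G H : Type u} [Group G] [Group H]
    (hGH : GroupElemEquiv G H) (F : Type u) [Field F]
    (hG : ∀ (v : FrameIndex n → G) (h : IsFrame hn v),
      letI := IsFieldLine.field h
      FieldElemEquiv (lineSet (v none)) F)
    (v : FrameIndex n → H) (h : IsFrame hn v) :
    letI := IsFieldLine.field h
    FieldElemEquiv (lineSet (v none)) F := by
  letI := IsFieldLine.field h
  letI := Ring.compatibleRingOfRing (lineSet (v none))
  letI := Ring.compatibleRingOfRing F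
  obtain ⟨I, hI⟩ := exists_lineInterpretation.{u} hn
  -- That `σ` holds in the fields of all frames is a group sentence true in `G`, hence in `H`. One
  -- implication is enough, as it also applies to the negation of `σ`.
  have key : ∀ σ : Language.ring.Sentence, F ⊨ σ → (lineSet (v none)) ⊨ σ := by
    intro σ hσ
    obtain ⟨φ, hφ⟩ := I.exists_formula.{u} σ
    have hdef : GroupDefinable.{u} fun M _ (_ : Empty → M) => ∀ w : FrameIndex n → M,
        IsFrame hn w → φ.Realize fun q => Sum.elim (fun q => q.1.elim) w q := by
      refine GroupDefinable.forall_tuple (GroupDefinable.imp (GroupDefinable.isFieldLine _ _ _)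
        (GroupDefinable.realize _ ?_))
      rintro (q | q)
      · exact q.1.elim
      · exact GroupTerm.var _
    have hreal : ∀ (M : Type u) [Group M] (w : FrameIndex n → M) (hw : IsFrame hn w),
        letI := IsFieldLine.field hw
        letI := Ring.compatibleRingOfRing (lineSet (w none))
        ((lineSet (w none)) ⊨ σ ↔ φ.Realize fun q => Sum.elim (fun q => q.1.elim) w q) := by
      intro M _ w hw
      letI := IsFieldLine.field hw
      letI := Ring.compatibleRingOfRing (lineSet (w none))
      refine (hφ M _ w _ (hI M w hw) default).trans (iff_of_eq ?_)
      congr 1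
      funext q
      rcases q with q | q
      · exact q.1.elim
      · rfl
    refine (hreal H v h).2 ((hdef.transfer hGH).1 (fun w hw => ?_) v h)
    refine (hreal G w hw).1 ?_
    letI := IsFieldLine.field hw
    letI := Ring.compatibleRingOfRing (lineSet (w none))
    exact (Language.ElementarilyEquivalent.realize_sentence (hG w hw) σ).2 hσ
  refine Language.elementarilyEquivalent_iff.2 fun σ => ⟨fun hσ => ?_, key σ⟩
  by_contra hF
  exact (Language.Sentence.realize_not _).1 (key σ.not ((Language.Sentence.realize_not _).2 hF)) hσ

end Coordinates

/-! ### Elementary matrices and the standard frame of `GL_n(F)` -/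

section StandardFrame

open Matrix

variable {F : Type*} [Field F] {n : ℕ}

theorem single_mul_single_self_of_ne {i j : Fin n} (h : i ≠ j) :
    Matrix.single i j (1 : F) * Matrix.single i j (1 : F) = 0 :=
  single_mul_single_of_ne _ _ _ _ h.symm _

/-- The elementary matrix `1 + b E_{ij}` as an element of the general linear group. -/
def elementaryGL {i j : Fin n} (h : i ≠ j) (b : F) : GL (Fin n) F :=
  sqZeroUnipotent (single_mul_single_self_of_ne h) b

theorem elementaryGL_val {i j : Fin n} (h : i ≠ j) (b : F) :
    (elementaryGL h b).val = transvection i j b := by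
  change 1 + b • Matrix.single i j (1 : F) = 1 + Matrix.single i j b
  rw [smul_single, smul_eq_mul, mul_one]

theorem elementaryGL_mul {i j : Fin n} (h : i ≠ j) (a b : F) :
    elementaryGL h a * elementaryGL h b = elementaryGL h (a + b) :=
  sqZeroUnipotent_mul _ a b

theorem elementaryGL_zero {i j : Fin n} (h : i ≠ j) : elementaryGL h (0 : F) = 1 :=
  Units.ext (by rw [elementaryGL_val, transvection_zero]; rfl)

theorem elementaryGL_inv {i j : Fin n} (h : i ≠ j) (a : F) :
    (elementaryGL h a)⁻¹ = elementaryGL h (-a) := by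
  rw [inv_eq_iff_mul_eq_one, elementaryGL_mul, add_neg_cancel, elementaryGL_zero]

theorem elementaryGL_injective {i j : Fin n} (h : i ≠ j) :
    Function.Injective (elementaryGL (F := F) h) :=
  sqZeroUnipotent_injective (single_mul_single_self_of_ne h) fun h0 => one_ne_zero
    (by simpa using congrFun (congrFun h0 i) j : (1 : F) = 0)

theorem elementaryGL_commutator {i j k : Fin n} (hij : i ≠ j) (hjk : j ≠ k) (hik : i ≠ k)
    (a b : F) :
    elementaryGL hij a * elementaryGL hjk b * (elementaryGL hij a)⁻¹ * (elementaryGL hjk b)⁻¹ =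
      elementaryGL hik (a * b) := by
  rw [mul_inv_eq_iff_eq_mul, mul_inv_eq_iff_eq_mul]
  refine Units.ext ?_
  simp only [Units.val_mul, elementaryGL_val, transvection, add_mul, mul_add, one_mul, mul_one,
    single_mul_single_same, single_mul_single_of_ne _ _ _ _ hjk.symm,
    single_mul_single_of_ne _ _ _ _ hik.symm, single_mul_single_of_ne _ _ _ _ hij.symm,
    add_zero, zero_mul, mul_zero]
  abel

/-- Permutation matrices permute the root subgroups, keeping the parameter `a`. -/
theorem exists_perm_conj {i₀ j₀ i j : Fin n} (h₀ : i₀ ≠ j₀) (h : i ≠ j) :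
    ∃ g : GL (Fin n) F, ∀ a : F, g * elementaryGL h₀ a * g⁻¹ = elementaryGL h a := by
  obtain ⟨σ, hi, hj⟩ : ∃ σ : Equiv.Perm (Fin n), σ i = i₀ ∧ σ j = j₀ := by
    refine ⟨(Equiv.swap i i₀).trans (Equiv.swap (Equiv.swap i i₀ j) j₀), ?_, ?_⟩
    · have h₁ : i₀ ≠ Equiv.swap i i₀ j := by
        intro h'
        apply h
        apply (Equiv.swap i i₀).injective
        rw [← h', Equiv.swap_apply_left]
      rw [Equiv.trans_apply, Equiv.swap_apply_left, Equiv.swap_apply_of_ne_of_ne h₁ h₀]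
    · rw [Equiv.trans_apply, Equiv.swap_apply_left]
  let g : GL (Fin n) F :=
    ⟨σ.toPEquiv.toMatrix, σ.symm.toPEquiv.toMatrix, by
      rw [← PEquiv.toMatrix_trans, ← Equiv.toPEquiv_trans, Equiv.self_trans_symm,
        Equiv.toPEquiv_refl, PEquiv.toMatrix_refl], by
      rw [← PEquiv.toMatrix_trans, ← Equiv.toPEquiv_trans, Equiv.symm_trans_self,
        Equiv.toPEquiv_refl, PEquiv.toMatrix_refl]⟩
  refine ⟨g, fun a => ?_⟩
  rw [mul_inv_eq_iff_eq_mul]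
  refine Units.ext ?_
  rw [Units.val_mul, Units.val_mul, elementaryGL_val, elementaryGL_val]
  change σ.toPEquiv.toMatrix * _ = _ * σ.toPEquiv.toMatrix
  rw [PEquiv.toMatrix_toPEquiv_mul, PEquiv.mul_toMatrix_toPEquiv]
  ext p q
  have e₁ : i₀ = σ p ↔ i = p := by rw [← hi, σ.injective.eq_iff]
  have e₂ : j = σ.symm q ↔ j₀ = q := by rw [← hj, Equiv.eq_symm_apply]
  simp [transvection, Matrix.one_apply, Matrix.single_apply, e₁, e₂, Equiv.eq_symm_apply]

/-- Conjugates of a unipotent in its double centralizer have scalar part `1`. Conversely, `diag(b,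
1, …, 1)` conjugates `e_{ij}(1)` to `e_{ij}(b)`, which uses that `i` is the first index. -/
theorem mem_lineSet_elementaryGL_iff [CharZero F] {i j : Fin n} (h : i ≠ j) (hi : (i : ℕ) = 0)
    (t : GL (Fin n) F) : t ∈ lineSet (elementaryGL h (1 : F)) ↔ ∃ b, t = elementaryGL h b := by
  have hn : 0 < n := i.pos
  constructor
  · intro ht
    rcases ht.2 with rfl | ⟨g, hg⟩
    · exact ⟨0, (elementaryGL_zero h).symm⟩
    · obtain ⟨a, b, hab, ha⟩ := exists_val_eq_of_inBicentralizer (X := elementaryGL h (1 : F)) (μ := 1)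
        hn (single_mul_single_self_of_ne h)
        (fun h0 => one_ne_zero (by simpa using congrFun (congrFun h0 i) j : (1 : F) = 0))
        (by rw [elementaryGL_val, one_smul]; rfl) ht.1
      refine ⟨b, Units.ext ?_⟩
      rw [hab, ha g hg, one_smul]
      rfl
  · rintro ⟨b, rfl⟩
    refine ⟨fun g hg => ?_, ?_⟩
    · have hg' := congrArg Units.val hg
      have h1 : (elementaryGL h (1 : F)).val = 1 + Matrix.single i j (1 : F) := elementaryGL_val _ _
      rw [Units.val_mul, Units.val_mul, h1, mul_add, add_mul, mul_one, one_mul] at hg'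
      refine Units.ext ?_
      change (1 + b • Matrix.single i j (1 : F)) * g.val = g.val * (1 + b • Matrix.single i j (1 : F))
      rw [mul_add, add_mul, mul_one, one_mul, smul_mul_assoc, mul_smul_comm, add_left_cancel hg']
    · by_cases hb : b = 0
      · left; rw [hb, elementaryGL_zero]
      · right
        refine ⟨dOne n (Units.mk0 b hb), ?_⟩
        rw [eq_mul_inv_iff_mul_eq]
        refine Units.ext ?_
        have hj : (j : ℕ) ≠ 0 := fun hj => h (Fin.ext (hi.trans hj.symm))
        rw [Units.val_mul, Units.val_mul, elementaryGL_val, elementaryGL_val]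
        change _ * diagonal _ = diagonal _ * _
        ext p q
        by_cases hp : i = p <;> by_cases hq : j = q
        · subst hp; subst hq
          simp [transvection, add_mul, mul_add, hi, hj, h]
        all_goals
          simp only [transvection, add_mul, mul_add, one_mul, mul_one, Matrix.add_apply,
            Matrix.mul_diagonal, Matrix.diagonal_mul, Matrix.single_apply, Matrix.diagonal_apply,
            hp, hq, false_and, and_false, if_false, zero_mul, mul_zero, add_zero]
          by_cases hpq : p = q <;> simp [hpq, mul_comm]

variable [CharZero F]

theorem isFieldLine_elementaryGL {i j k : Fin n} (hij : i ≠ j) (hik : i ≠ k) (hkj : k ≠ j)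
    (hi : (i : ℕ) = 0) {P Q : GL (Fin n) F}
    (hP : ∀ a : F, P * elementaryGL hij a * P⁻¹ = elementaryGL hik a)
    (hQ : ∀ a : F, Q * elementaryGL hij a * Q⁻¹ = elementaryGL hkj a) :
    IsFieldLine (elementaryGL hij (1 : F)) P Q := by
  have hmem : ∀ b, elementaryGL hij b ∈ lineSet (elementaryGL hij (1 : F)) :=
    fun b => (mem_lineSet_elementaryGL_iff hij hi _).2 ⟨b, rfl⟩
  have hm : ∀ a b, lineMul P Q (elementaryGL hij a) (elementaryGL hij b) =
      elementaryGL hij (a * b) := by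
    intro a b
    rw [lineMul, hP, hQ, elementaryGL_commutator]
  simp only [isFieldLine_iff, mem_lineSet_elementaryGL_iff hij hi, forall_exists_index,
    forall_eq_apply_imp_iff]
  refine ⟨fun a b => ⟨_, elementaryGL_mul _ _ _⟩, fun a => ⟨_, elementaryGL_inv _ _⟩,
    fun a b => by rw [elementaryGL_mul, elementaryGL_mul, add_comm], fun h => ?_,
    fun a b => ⟨_, hm _ _⟩, fun a b => by rw [hm, hm, mul_comm],
    fun a b c => by rw [hm, hm, hm, hm, mul_assoc],
    fun a b c => by rw [elementaryGL_mul, hm, hm, hm, elementaryGL_mul, mul_add],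
    fun a => by rw [hm, one_mul], fun a ha => ?_, fun y hy => ?_⟩
  · rw [elementaryGL_mul, ← elementaryGL_zero hij] at h
    exact absurd (elementaryGL_injective hij h) (by norm_num)
  · have ha0 : a ≠ 0 := fun h => ha (by rw [h, elementaryGL_zero])
    exact ⟨_, ⟨a⁻¹, rfl⟩, by rw [hm, mul_inv_cancel₀ ha0]⟩
  · obtain ⟨a, b, hab, -⟩ := exists_val_eq_of_inBicentralizer (X := elementaryGL hij (1 : F)) (μ := 1)
        i.pos (single_mul_single_self_of_ne hij)
        (fun h0 => one_ne_zero (by simpa using congrFun (congrFun h0 i) j : (1 : F) = 0))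
        (by rw [elementaryGL_val, one_smul]; rfl) hy
    -- Otherwise `y ^ 2 = 0` for an invertible `y`. Then `y = a (1 + a⁻¹ b E_{ij})` is the required
    -- central factorization.
    have ha : a ≠ 0 := by
      rintro rfl
      have : y.val * y.val = 0 := by
        rw [hab, zero_smul, zero_add, smul_mul_assoc, mul_smul_comm,
          single_mul_single_self_of_ne hij, smul_zero, smul_zero]
      have hy0 : y.val = 0 := y.isUnit.mul_left_eq_zero.1 this
      have : IsUnit (0 : Matrix (Fin n) (Fin n) F) := hy0 ▸ y.isUnit
      have h01 := isUnit_zero_iff.1 this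
      exact one_ne_zero (by simpa using (congrFun (congrFun h01 i) i).symm : (1 : F) = 0)
    refine ⟨GeneralLinearGroup.scalar (Fin n) (Units.mk0 a ha),
      GL_central_iff_exists_smul_one.2 ⟨a, ?_⟩, _, ⟨a⁻¹ * b, rfl⟩, Units.ext ?_⟩
    · rw [smul_one_eq_diagonal]; rfl
    · rw [Units.val_mul, hab]
      change _ = diagonal (fun _ => a) * (1 + (a⁻¹ * b) • Matrix.single i j (1 : F))
      rw [← smul_one_eq_diagonal, smul_mul_assoc, one_mul, smul_add, smul_smul,
        mul_inv_cancel_left₀ ha]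

/-- The standard frame of `GL_n(F)` is coordinatizing, if each nonzero element of `F` is up to sign
a power with exponent `2 n`, in an essentially unique way. -/
theorem exists_coordinatizingFrame_GL (hn : 3 ≤ n)
    (hroot : ∀ a : F, a ≠ 0 → ∃ b : F, b ^ (2 * n) = a ∨ b ^ (2 * n) = -a)
    (hone : ∀ b : F, b ^ (2 * n) = 1 ∨ b ^ (2 * n) = -1 → b * b = 1) :
    ∃ v : FrameIndex n → GL (Fin n) F, CoordinatizingFrame hn v := by
  have hn0 : 0 < n := by omega
  have ne : ∀ i j : Fin 3, i ≠ j → Fin.castLE hn i ≠ Fin.castLE hn j :=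
    fun i j h h' => h (Fin.castLE_injective hn h')
  have h01 := ne 0 1 (by decide)
  have h02 := ne 0 2 (by decide)
  have h21 := ne 2 1 (by decide)
  have hz : ((Fin.castLE hn 0 : Fin n) : ℕ) = 0 := rfl
  choose p hp using fun q : {q : Fin n × Fin n // q.1 ≠ q.2} =>
    exists_perm_conj (F := F) h01 q.2
  let v : FrameIndex n → GL (Fin n) F := fun
    | none => elementaryGL h01 1
    | some none => dOne n (-1)
    | some (some q) => p q
  have hv : IsFrame hn v := isFieldLine_elementaryGL h01 h02 h21 hz (hp _) (hp _)
  letI := IsFieldLine.field hv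
  have hline : ∀ x : lineSet (v none), ∃ b, x.1 = elementaryGL h01 b :=
    fun x => (mem_lineSet_elementaryGL_iff h01 hz x.1).1 x.2
  let θ : F →+* lineSet (v none) :=
    { toFun := fun b => ⟨elementaryGL h01 b, (mem_lineSet_elementaryGL_iff h01 hz _).2 ⟨b, rfl⟩⟩
      map_one' := rfl
      map_zero' := Subtype.ext (elementaryGL_zero h01)
      map_add' := fun a b => Subtype.ext (elementaryGL_mul h01 a b).symm
      map_mul' := fun a b => Subtype.ext (by
        change _ = lineMul _ _ (elementaryGL h01 a) (elementaryGL h01 b)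
        rw [lineMul]
        change _ = (p _ * _ * (p _)⁻¹) * (p _ * _ * (p _)⁻¹) * (p _ * _ * (p _)⁻¹)⁻¹ *
          (p _ * _ * (p _)⁻¹)⁻¹
        rw [hp, hp]
        exact (elementaryGL_commutator h02 h21 h01 a b).symm) }
  have hθ : ∀ x : lineSet (v none), ∃ b, x = θ b := fun x =>
    (hline x).imp fun b hb => Subtype.ext hb
  have hword : ∀ {N : ℕ} (π : Fin N → Letter n) (x : Fin N → F),
      (wordElem v π fun k => (θ (x k)).1).val = wordMatrix π x := by
    intro N π x
    rw [wordElem, wordMatrix]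
    induction List.finRange N with
    | nil => rfl
    | cons k l ih =>
      rw [List.map_cons, List.prod_cons, List.map_cons, List.prod_cons, Units.val_mul, ih]
      congr 1
      rcases π k with _ | q
      · simp [letterElem, letterMatrix, v, dOne]
      · change (p q * elementaryGL h01 (x k) * (p q)⁻¹).val = _
        rw [hp, elementaryGL_val]
        rfl
  have hmap : ∀ {N : ℕ} (π : Fin N → Letter n) (x : Fin N → F),
      wordMatrix π (fun k => θ (x k)) = (wordMatrix π x).map θ := by
    intro N π x
    rw [wordMatrix, wordMatrix, ← RingHom.mapMatrix_apply, map_list_prod, List.map_map]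
    congr 1
    refine List.map_congr_left fun k _ => ?_
    rw [Function.comp_apply, RingHom.mapMatrix_apply]
    rcases π k with _ | q
    · ext i j
      simp only [letterMatrix, diagonal_apply, map_apply]
      split_ifs <;> simp
    · ext i j
      simp only [letterMatrix, transvection, Matrix.add_apply, Matrix.one_apply,
        Matrix.single_apply, map_apply, map_add]
      split_ifs <;> simp
  have hinj : Function.Injective fun A : Matrix (Fin n) (Fin n) F => A.map θ :=
    Matrix.map_injective θ.injective
  refine ⟨v, hv, fun π₁ π₂ π₃ x y z => ?_, fun g => ?_, fun π x z hz hxz => ?_⟩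
  · choose x' hx' using fun k => hθ (x k)
    choose y' hy' using fun k => hθ (y k)
    choose z' hz' using fun k => hθ (z k)
    obtain rfl : x = fun k => θ (x' k) := funext hx'
    obtain rfl : y = fun k => θ (y' k) := funext hy'
    obtain rfl : z = fun k => θ (z' k) := funext hz'
    rw [hmap, hmap, hmap, ← Matrix.map_mul, hinj.eq_iff, ← hword, ← hword, ← hword,
      ← Units.val_mul, Units.ext_iff]
  · have hg : g.val.det ≠ 0 := by
      rw [← GeneralLinearGroup.val_det_apply]
      exact Units.ne_zero _
    -- With `det g = ±b ^ (2 n)`, dividing `g` by the scalar `b ^ 2` leaves determinant `±1`.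
    obtain ⟨b, hb⟩ := hroot _ hg
    have hb0 : b ≠ 0 := by
      rintro rfl
      rw [zero_pow (by omega)] at hb
      rcases hb with hb | hb
      · exact hg hb.symm
      · exact hg (neg_eq_zero.1 hb.symm)
    obtain ⟨π, x, hx⟩ := exists_wordMatrix_eq (by omega) ((b * b)⁻¹ • g.val) (by
      have hbb : ((b * b)⁻¹) ^ n * b ^ (2 * n) = 1 := by
        rw [pow_mul, pow_two, ← mul_pow, inv_mul_cancel₀ (mul_ne_zero hb0 hb0), one_pow]
      rw [det_smul, Fintype.card_fin]
      rcases hb with hb | hb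
      · left; rw [← hb, hbb]
      · right; rw [← neg_eq_iff_eq_neg, ← mul_neg, ← hb, hbb])
    refine ⟨π, fun k => θ (x k), GeneralLinearGroup.scalar (Fin n) (Units.mk0 b hb0),
      GL_central_iff_exists_smul_one.2 ⟨b, ?_⟩, Units.ext ?_⟩
    · rw [smul_one_eq_diagonal]; rfl
    · rw [Units.val_mul, hword, ← hx, Units.val_mul]
      change g.val = _ * (diagonal (fun _ => b) * diagonal fun _ => b)
      rw [← smul_one_eq_diagonal, smul_mul_smul_comm, mul_one, mul_smul_comm, mul_one, smul_smul,
        mul_inv_cancel₀ (mul_ne_zero hb0 hb0), one_smul]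
  · obtain ⟨c, hc⟩ := GL_central_iff_exists_smul_one.1 hz
    choose x' hx' using fun k => hθ (x k)
    obtain rfl : x = fun k => θ (x' k) := funext hx'
    have h1 := congrArg Units.val hxz
    have h2 : (z * z).val = (c * c) • (1 : Matrix (Fin n) (Fin n) F) := by
      rw [Units.val_mul, hc, smul_mul_smul_comm, mul_one]
    rw [hword, h2] at h1
    -- A word has determinant `±1`, so a scalar word `c ^ 2` satisfies `c ^ (2 n) = ±1`, and `hone`
    -- gives `c ^ 2 = 1`.
    have h3 : (wordMatrix π x').det = c ^ (2 * n) := by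
      rw [h1, det_smul, det_one, mul_one, Fintype.card_fin, pow_mul, pow_two]
    have h4 := hone c (by rw [← h3]; exact det_wordMatrix hn0 π x')
    refine Units.ext ?_
    rw [h2, h4, one_smul]
    rfl

end StandardFrame

open Matrix

/-! ### Interpretations of `slDOne` and of the group of squares of central elements -/

theorem GroupElemEquiv.centerSquares {G H : Type u} [Group G] [Group H]
    (h : GroupElemEquiv G H) : GroupElemEquiv (centerSquares G) (centerSquares H) := by
  obtain ⟨D, hD⟩ : GroupDefinable.{u} fun M _ (v : Unit ⊕ Empty → M) =>
      ∃ z : M, (∀ g, g * z = z * g) ∧ z * z = v (Sum.inl ()) :=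
    GroupDefinable.exists_elem (GroupDefinable.and (GroupDefinable.forall_elem (GroupDefinable.eq
      (GroupTerm.mul (GroupTerm.var _) (GroupTerm.var _))
      (GroupTerm.mul (GroupTerm.var _) (GroupTerm.var _))))
      (GroupDefinable.eq (GroupTerm.mul (GroupTerm.var _) (GroupTerm.var _)) (GroupTerm.var _)))
  let I : TermInterpretation groupLanguage groupLanguage Empty Unit :=
    ⟨D, fun {_} f _ => Language.Term.func f fun k => Language.Term.var (Sum.inl (k, ()))⟩
  have hI : ∀ (M : Type u) [Group M], I.Realizes (Empty.elim : Empty → M)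
      fun (x : _root_.centerSquares M) (_ : Unit) => x.1 := by
    intro M _
    refine ⟨fun x y hxy => Subtype.ext (congrFun hxy ()), fun y => ?_, fun {k} f x i => ?_⟩
    · refine (hD M _).trans ⟨?_, ?_⟩
      · rintro ⟨z, hz, hzy⟩
        exact ⟨⟨y (), z, Subgroup.mem_center_iff.2 hz, (pow_two z).trans hzy⟩, rfl⟩
      · rintro ⟨⟨_, z, hz, rfl⟩, rfl⟩
        exact ⟨z, Subgroup.mem_center_iff.1 hz, (pow_two z).symm⟩
    · cases f <;> rfl
  exact I.elementarilyEquivalent (hI G) (hI H) h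

/-- Group elements are coded by their `n ^ 2` entries, subject to the polynomial condition `det =
±1`. -/
theorem FieldElemEquiv.slDOne {n : ℕ} (hn : 0 < n) {K L : Type u} [Field K] [Field L]
    (h : FieldElemEquiv K L) : GroupElemEquiv (slDOne n K) (slDOne n L) := by
  let X : ∀ {k : ℕ}, Fin k → ∀ (F : Type u) [Field F],
      ((Fin k × Fin n × Fin n) ⊕ Empty → F) → Matrix (Fin n) (Fin n) F :=
    fun k F _ v => Matrix.of fun i j => v (Sum.inl (k, i, j))
  have hX : ∀ {k : ℕ} (a : Fin k) (i j : Fin n), RingTerm.{u} fun F _ v => X a F v i j :=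
    fun a i j => RingTerm.var _
  have hdet : RingTerm.{u} fun F _ (v : (Fin n × Fin n) ⊕ Empty → F) =>
      (Matrix.of fun i j => v (Sum.inl (i, j))).det :=
    RingTerm.matrix_det fun i j => RingTerm.var _
  obtain ⟨D₁, hD₁⟩ := hdet.exists_eq_formula RingTerm.one
  obtain ⟨D₂, hD₂⟩ := hdet.exists_eq_formula RingTerm.one.neg
  choose tm htm using RingTerm.matrix_mul (hX (0 : Fin 2)) (hX (1 : Fin 2))
  -- Inversion is a ring term here: a determinant `±1` is its own inverse, so `A⁻¹ = det A • adj A`.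
  choose ti hti using fun i j => (RingTerm.matrix_det (hX (0 : Fin 1))).mul
    (RingTerm.matrix_adjugate (hX (0 : Fin 1)) i j)
  choose te hte using RingTerm.matrix_one.{u} (α := (Fin 0 × Fin n × Fin n) ⊕ Empty) (n := n)
  let I : TermInterpretation Language.ring groupLanguage Empty (Fin n × Fin n) :=
    ⟨D₁ ⊔ D₂, fun {k} f q => match k, f with
      | _, GroupFunc.mul => tm q.1 q.2
      | _, GroupFunc.inv => ti q.1 q.2
      | _, GroupFunc.one => te q.1 q.2⟩
  have hI : ∀ (F : Type u) [Field F],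
      letI := Ring.compatibleRingOfRing F
      I.Realizes (Empty.elim : Empty → F)
        fun (A : _root_.slDOne n F) (q : Fin n × Fin n) => A.1.val q.1 q.2 := by
    intro F _
    letI := Ring.compatibleRingOfRing F
    refine ⟨fun A B hAB => Subtype.ext (Units.ext (Matrix.ext fun i j => congrFun hAB (i, j))),
      fun y => ?_, fun {k} f x q => ?_⟩
    · rw [Language.Formula.realize_sup, hD₁, hD₂]
      change (Matrix.of fun i j => y (i, j)).det = 1 ∨ (Matrix.of fun i j => y (i, j)).det = -1 ↔ _
      constructor
      · intro hy
        have hu : IsUnit (Matrix.of fun i j => y (i, j)) := by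
          rw [isUnit_iff_isUnit_det]
          rcases hy with hd | hd <;> simp [hd]
        exact ⟨⟨hu.unit, (mem_slDOne_iff hn _).2 (by rw [IsUnit.unit_spec]; exact hy)⟩, rfl⟩
      · rintro ⟨A, rfl⟩
        exact (mem_slDOne_iff hn _).1 A.2
    · cases f
      · exact (htm q.1 q.2 F (Sum.elim (fun r => (x r.1).1.val r.2.1 r.2.2) Empty.elim)).symm
      · refine Eq.trans ?_
          (hti q.1 q.2 F (Sum.elim (fun r => (x r.1).1.val r.2.1 r.2.2) Empty.elim)).symm
        change (x 0).1⁻¹.val q.1 q.2 = (x 0).1.val.det * (x 0).1.val.adjugate q.1 q.2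
        have hA := (mem_slDOne_iff hn _).1 (x 0).2
        rw [GeneralLinearGroup.coe_inv, Matrix.inv_def, Matrix.smul_apply, smul_eq_mul]
        rcases hA with hA | hA <;> simp [hA]
      · exact (hte q.1 q.2 F (Sum.elim (fun r => (x r.1).1.val r.2.1 r.2.2) Empty.elim)).symm
  letI := Ring.compatibleRingOfRing K
  letI := Ring.compatibleRingOfRing L
  exact I.elementarilyEquivalent (hI K) (hI L) h

/-! ### The real case -/

section Real

variable {n : ℕ}

/-- Transfer compares groups in a single universe, so `ℝ` is lifted to the universe of `H`. -/
instance charZero_uLift_real : CharZero (ULift.{u} ℝ) :=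
  charZero_of_injective_ringHom
    (f := ((ULift.ringEquiv.{0, u} (R := ℝ)).symm : ℝ →+* ULift.{u} ℝ))
    (ULift.ringEquiv.{0, u} (R := ℝ)).symm.injective

theorem exists_pow_eq_or_neg (hn : 0 < n) (a : ULift.{u} ℝ) (_ : a ≠ 0) :
    ∃ b : ULift.{u} ℝ, b ^ (2 * n) = a ∨ b ^ (2 * n) = -a := by
  have h : (|a.down| ^ (((2 * n : ℕ) : ℝ)⁻¹)) ^ (2 * n) = |a.down| :=
    Real.rpow_inv_natCast_pow (abs_nonneg _) (by omega)
  refine ⟨⟨|a.down| ^ (((2 * n : ℕ) : ℝ)⁻¹)⟩, ?_⟩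
  rcases abs_choice a.down with ha | ha
  · left; exact ULift.ext _ _ (h.trans ha)
  · right; exact ULift.ext _ _ (h.trans ha)

theorem mul_self_eq_one_of_pow (hn : 0 < n) (b : ULift.{u} ℝ)
    (h : b ^ (2 * n) = 1 ∨ b ^ (2 * n) = -1) : b * b = 1 := by
  have hb : (b.down * b.down) ^ n = 1 := by
    rw [← pow_two, ← pow_mul]
    rcases h with h | h
    · exact congrArg ULift.down h
    · have h1 : b.down ^ (2 * n) = -1 := congrArg ULift.down h
      have h2 : 0 ≤ b.down ^ (2 * n) := by rw [pow_mul]; positivity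
      linarith
  exact ULift.ext _ _ ((pow_eq_one_iff_of_nonneg (mul_self_nonneg _) hn.ne').1 hb)

/-- Positive reals embed in the general linear group as scalar matrices. -/
noncomputable def posScalar (n : ℕ) : Units.posSubgroup ℝ →* GL (Fin n) (ULift.{u} ℝ) :=
  (GeneralLinearGroup.scalar (Fin n)).comp
    ((Units.map (ULift.ringEquiv.{0, u} (R := ℝ)).symm.toMonoidHom).comp
      (Units.posSubgroup ℝ).subtype)

theorem posScalar_val (r : Units.posSubgroup ℝ) :
    (posScalar.{u} n r).val =
      (ULift.up r.1.val : ULift.{u} ℝ) • (1 : Matrix (Fin n) (Fin n) (ULift.{u} ℝ)) := by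
  rw [smul_one_eq_diagonal]
  rfl

/-- The centre consists of the nonzero scalars, and the squares of nonzero reals are exactly the
positive reals. -/
theorem nonempty_posSubgroup_mulEquiv (hn : 0 < n) :
    Nonempty (Units.posSubgroup ℝ ≃* centerSquares (GL (Fin n) (ULift.{u} ℝ))) := by
  have hmem : ∀ r, posScalar.{u} n r ∈ centerSquares (GL (Fin n) (ULift.{u} ℝ)) := by
    intro r
    have hr : 0 < r.1.val := r.2
    have hs : Real.sqrt r.1.val ≠ 0 := (Real.sqrt_pos.2 hr).ne'
    let s : Units.posSubgroup ℝ := ⟨Units.mk0 _ hs, Real.sqrt_pos.2 hr⟩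
    refine ⟨posScalar n s, Subgroup.mem_center_iff.2
      (GL_central_iff_exists_smul_one.2 ⟨_, posScalar_val s⟩), ?_⟩
    rw [← map_pow]
    congr 1
    exact Subtype.ext (Units.ext (Real.sq_sqrt hr.le))
  refine ⟨MulEquiv.ofBijective ((posScalar.{u} n).codRestrict _ hmem) ⟨fun r s h => ?_, ?_⟩⟩
  · have h1 : posScalar.{u} n r = posScalar n s := congrArg Subtype.val h
    have h2 := congrArg Units.val h1
    rw [posScalar_val, posScalar_val] at h2
    have h3 := congrFun (congrFun h2 ⟨0, hn⟩) ⟨0, hn⟩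
    simp only [Matrix.smul_apply, Matrix.one_apply_eq, smul_eq_mul, mul_one] at h3
    exact Subtype.ext (Units.ext (congrArg ULift.down h3))
  · rintro ⟨_, z, hz, rfl⟩
    obtain ⟨c, hc⟩ := GL_central_iff_exists_smul_one.1 (Subgroup.mem_center_iff.1 hz)
    have hc0 : c.down ≠ 0 := by
      intro h0
      have hc0 : c = 0 := ULift.ext _ _ h0
      rw [hc0, zero_smul] at hc
      have hu : IsUnit (0 : Matrix (Fin n) (Fin n) (ULift.{u} ℝ)) := hc ▸ z.isUnit
      have h1 : (0 : Matrix (Fin n) (Fin n) (ULift.{u} ℝ)) = 1 := isUnit_zero_iff.1 hu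
      have h2 := congrFun (congrFun h1 ⟨0, hn⟩) ⟨0, hn⟩
      simp at h2
    have hpos : 0 < c.down ^ 2 := by positivity
    refine ⟨⟨Units.mk0 _ hpos.ne', hpos⟩, Subtype.ext (Units.ext ?_)⟩
    change (posScalar n _).val = (z ^ 2).val
    rw [posScalar_val, Units.val_pow_eq_pow_val, hc, _root_.smul_pow, one_pow]
    rfl

theorem groupElemEquiv_GL_real :
    GroupElemEquiv (GL (Fin n) (ULift.{u} ℝ)) (GL (Fin n) ℝ) :=
  GroupElemEquiv.of_mulEquiv
    (Units.mapEquiv (ULift.ringEquiv.{0, u} (R := ℝ)).mapMatrix.toMulEquiv)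

end Real

/-! ### The equivalence of the three conditions -/

theorem mainTheorem12 (n : ℕ) (hn : 3 ≤ n) (H : Type u) [Group H] :
    List.TFAE [
      GroupElemEquiv H (GL (Fin n) ℝ),
      ∃ (L : Type u) (_ : Field L), FieldElemEquiv L ℝ ∧
        GroupElemEquiv (centerSquares H) (Units.posSubgroup ℝ) ∧
        Nonempty (H ≃* slDOne n L × centerSquares H),
      ∃ (L : Type u) (_ : Field L) (B : Type u) (_ : Group B), FieldElemEquiv L ℝ ∧
        GroupElemEquiv B (Units.posSubgroup ℝ) ∧
        Nonempty (H ≃* slDOne n L × B)] := by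
  have hn0 : 0 < n := by omega
  have hR : FieldElemEquiv (ULift.{u} ℝ) ℝ := FieldElemEquiv.of_ringEquiv ULift.ringEquiv
  obtain ⟨β⟩ := nonempty_posSubgroup_mulEquiv.{u} hn0
  obtain ⟨w, hw⟩ := exists_coordinatizingFrame_GL (F := ULift.{u} ℝ) hn
    (exists_pow_eq_or_neg hn0) (mul_self_eq_one_of_pow hn0)
  have hlines : ∀ (v : FrameIndex n → GL (Fin n) (ULift.{u} ℝ)) (h : IsFrame hn v),
      letI := IsFieldLine.field h
      Nonempty (ULift.{u} ℝ ≃+* lineSet (v none)) :=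
    fun v h => IsFieldLine.nonempty_ringEquiv hn0 h
  tfae_have 1 → 2 := by
    intro h
    have hG : GroupElemEquiv (GL (Fin n) (ULift.{u} ℝ)) H := groupElemEquiv_GL_real.trans h.symm
    obtain ⟨v, hv⟩ := ((groupDefinable_coordinatizingFrame.{u} hn).transfer hG).1 ⟨w, hw⟩
    letI := hv.isFrame.field
    refine ⟨lineSet (v none), inferInstance, ?_, ?_, hv.nonempty_mulEquiv⟩
    · refine FieldElemEquiv.trans ?_ hR
      -- The frame `v` of `H` bears no relation to `w`, so the fields of all frames of the real
      -- group are needed.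
      refine fieldElemEquiv_of_frames hn hG _ (fun v' h' => ?_) v hv.isFrame
      obtain ⟨f⟩ := hlines v' h'
      letI := IsFieldLine.field h'
      exact FieldElemEquiv.of_ringEquiv f.symm
    · exact hG.symm.centerSquares.trans (GroupElemEquiv.of_mulEquiv β.symm)
  tfae_have 2 → 3 := fun ⟨L, hL, h₁, h₂, h₃⟩ =>
    ⟨L, hL, centerSquares H, inferInstance, h₁, h₂, h₃⟩
  tfae_have 3 → 1 := by
    rintro ⟨L, _, B, _, hL, hB, ⟨f⟩⟩
    letI := hw.isFrame.field
    obtain ⟨φ⟩ := hlines w hw.isFrame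
    -- The standard frame splits `GL_n(ℝ)` in the same way, so the two products can be compared
    -- factor by factor.
    obtain ⟨g⟩ := hw.nonempty_mulEquiv
    have h₁ : GroupElemEquiv (slDOne n L) (slDOne n (lineSet (w none))) :=
      ((hL.trans hR.symm).trans (FieldElemEquiv.of_ringEquiv φ)).slDOne hn0
    have h₂ : GroupElemEquiv B (centerSquares (GL (Fin n) (ULift.{u} ℝ))) :=
      hB.trans (GroupElemEquiv.of_mulEquiv β)
    exact (((GroupElemEquiv.of_mulEquiv f).trans (h₁.prod h₂)).trans
      (GroupElemEquiv.of_mulEquiv g.symm)).trans groupElemEquiv_GL_real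
  tfae_finish
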